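/- Let $n\ge 2$, $1<\rho<n$, and let $\alpha,\beta$ be real numbers with $\alpha\ge\frac{\rho n}{\rho n+\rho-n}$ and $1<\alpha<\beta<n$. Let $A(t)=\int_0^t a(s)\,ds$ be a Young function, where $a:[0,\infty)\to[0,\infty)$ is nondecreasing and left-continuous with $a(0)=0$. For $\sigma>0$ write $A_\sigma(t)=A(t^\sigma)$, and for measurable $g$ on $\mathbb{R}^n$ (real- or vector-valued) put $$\|g\|_{L^{A_\sigma}}=\inf\Big\{\lambda>0:\int_{\mathbb{R}^n}A_\sigma(|g(x)|/\lambda)\,dx\le 1\Big\}\in[0,\infty],\qquad \|g\|_{L^A}=\|g\|_{L^{A_1}}.$$ Suppose that $A_{\frac1\alpha-\frac1\beta}$ satisfies the $\nabla_2$-condition: there is $K>1$ with $A_{\frac1\alpha-\frac1\beta}(r)\le\frac1{2K}A_{\frac1\alpha-\frac1\beta}(Kr)$ for all $r\ge 0$. Then there is a finite constant $C$, depending only on $n,\rho,\alpha,\beta,A$, with the following property. Let $\Omega\in L^1(\mathbb{S}^{n-1})\cap L^\rho(\mathbb{S}^{n-1})$ be real-valued with $\int_{\mathbb{S}^{n-1}}\Omega\,d\sigma=0$,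 and let $f:\mathbb{R}^n\to\mathbb{R}$ be a locally integrable function whose weak gradient $\nabla f$ is locally integrable and belongs to the homogeneous Morrey space $\dot{\mathcal M}^{\alpha,\frac{\alpha n}{\beta}}(\mathbb{R}^n)$, i.e. $$\|\nabla f\|_{\dot{\mathcal M}^{\alpha,\frac{\alpha n}{\beta}}}=\sup_{x\in\mathbb{R}^n,\,r>0}\Big(\frac1{r^{\,n-\beta}}\int_{B(x,r)}|\nabla f(y)|^\alpha\,dy\Big)^{1/\alpha}<\infty.$$ Then for almost every $x\in\mathbb{R}^n$ the principal value $$T_\Omega f(x)=\mathrm{p.v.}\int_{\mathbb{R}^n}\frac{\Omega(y/|y|)}{|y|^n}f(x-y)\,dy=\lim_{\varepsilon\to0^+,\,R\to\infty}\int_{\varepsilon<|y|<R}\frac{\Omega(y/|y|)}{|y|^n}f(x-y)\,dy$$ exists (the integrals over the annuli being absolutely convergent), $T_\Omega f$ is measurable, and $$\|T_\Omega f\|_{L^A}\le C\,\|\Omega\|_{L^\rho(\mathbb{S}^{n-1})}\,\|\nabla f\|_{\dot{\mathcal M}^{\alpha,\frac{\alpha n}{\beta}}}^{\frac\alpha\beta}\,\|\nabla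 f\|_{L^{A_{1-\frac\alpha\beta}}}^{1-\frac\alpha\beta},$$ with the convention $0\cdot\infty=0$ on the right-hand side. -/

import Mathlib

open MeasureTheory Filter Topology
open scoped ENNReal NNReal

noncomputable section

namespace RoughOrlicz

/-- Euclidean space `ℝⁿ`, with the Euclidean norm and Lebesgue measure. -/
abbrev E (n : ℕ) : Type := EuclideanSpace ℝ (Fin n)

/-- The unit sphere of `ℝⁿ`. -/
abbrev Sph (n : ℕ) : Type := Metric.sphere (0 : E n) 1

/-- The surface measure of the unit sphere. -/
def surf (n : ℕ) : Measure (Sph n) := (volume : Measure (E n)).toSphere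

/-- The point `y / |y|` of the sphere, for `y ≠ 0`. -/
def direction {n : ℕ} (y : E n) (hy : y ≠ 0) : Sph n :=
  ⟨‖y‖⁻¹ • y, by
    rw [mem_sphere_zero_iff_norm, norm_smul, norm_inv, norm_norm,
      inv_mul_cancel₀ (norm_ne_zero_iff.mpr hy)]⟩

open Classical in
/-- The rough kernel `Ω(y/|y|) / |y|ⁿ` (the value at the origin is irrelevant). -/
def roughKernel {n : ℕ} (Ω : Sph n → ℝ) (y : E n) : ℝ :=
  if hy : y ≠ 0 then Ω (direction y hy) / ‖y‖ ^ n else 0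

/-- The open annulus `ε < |y| < R`. -/
def annulus (n : ℕ) (ε R : ℝ) : Set (E n) := {y | ε < ‖y‖ ∧ ‖y‖ < R}

/-- The truncated integral `∫_{ε < |y| < R} Ω(y/|y|) |y|⁻ⁿ f(x - y) dy`. -/
def truncatedIntegral {n : ℕ} (Ω : Sph n → ℝ) (f : E n → ℝ) (x : E n) (ε R : ℝ) : ℝ :=
  ∫ y in annulus n ε R, roughKernel Ω y * f (x - y)

/-- The principal value `p.v. ∫ Ω(y/|y|) |y|⁻ⁿ f(x - y) dy` exists and equals `L`: the integrand is
integrable on every annulus, and the truncated integrals converge as `ε → 0⁺` and `R → ∞`. -/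
def HasPrincipalValue {n : ℕ} (Ω : Sph n → ℝ) (f : E n → ℝ) (x : E n) (L : ℝ) : Prop :=
  (∀ ε R : ℝ, 0 < ε → IntegrableOn (fun y => roughKernel Ω y * f (x - y)) (annulus n ε R)) ∧
    Tendsto (fun p : ℝ × ℝ => truncatedIntegral Ω f x p.1 p.2) (𝓝[>] (0 : ℝ) ×ˢ atTop) (𝓝 L)

/-- The rough singular integral operator `T_Ω`. -/
def roughOperator {n : ℕ} (Ω : Sph n → ℝ) (f : E n → ℝ) (x : E n) : ℝ :=
  limUnder (𝓝[>] (0 : ℝ) ×ˢ atTop) fun p : ℝ × ℝ => truncatedIntegral Ω f x p.1 p.2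

/-- `g` is the weak (distributional) gradient of the locally integrable function `f`. -/
structure IsWeakGradient {n : ℕ} (f : E n → ℝ) (g : E n → E n) : Prop where
  locallyIntegrable : LocallyIntegrable f
  locallyIntegrable_grad : LocallyIntegrable g
  integral_eq : ∀ φ : E n → ℝ, ContDiff ℝ (⊤ : ℕ∞) φ → HasCompactSupport φ → ∀ v : E n,
    ∫ x, f x * fderiv ℝ φ x v = -∫ x, inner ℝ (g x) v * φ x

/-- The homogeneous Morrey norm
`sup_{x, r > 0} (r^{-n(1-p/q)} ∫_{B(x,r)} |g|^p)^{1/p}`, with values in `[0, ∞]`. -/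
def morreyNorm {n : ℕ} {F : Type*} [NormedAddCommGroup F] (p q : ℝ) (g : E n → F) : ℝ≥0∞ :=
  ⨆ (x : E n) (r : ℝ) (_ : 0 < r),
    ((∫⁻ y in Metric.ball x r, ‖g y‖ₑ ^ p) / ENNReal.ofReal (r ^ ((n : ℝ) * (1 - p / q)))) ^ (1 / p)

/-- Membership in the homogeneous Morrey space (finiteness of the norm entails that `g` is locally
in `L^p`). -/
def MemMorrey {n : ℕ} {F : Type*} [NormedAddCommGroup F] (p q : ℝ) (g : E n → F) : Prop :=
  AEStronglyMeasurable g volume ∧ morreyNorm p q g < ⊤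

/-- `A` is (on `[0, ∞)`) a Young function: `A(t) = ∫₀ᵗ a(s) ds` with `a : [0, ∞) → [0, ∞)`
nondecreasing, left-continuous and `a(0) = 0` (so `a ≥ 0` automatically). -/
def IsYoung (A : ℝ → ℝ) : Prop :=
  ∃ a : ℝ → ℝ, a 0 = 0 ∧ MonotoneOn a (Set.Ici 0) ∧
    (∀ s, 0 < s → ContinuousWithinAt a (Set.Iic s) s) ∧
    ∀ t, 0 ≤ t → A t = ∫ s in (0 : ℝ)..t, a s

/-- The `∇₂`-condition. -/
def Nabla2 (A : ℝ → ℝ) : Prop :=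
  ∃ K : ℝ, 1 < K ∧ ∀ r, 0 ≤ r → A r ≤ 1 / (2 * K) * A (K * r)

/-- The rescaled function `A_σ(t) = A(t^σ)`. -/
def rescale (A : ℝ → ℝ) (σ : ℝ) : ℝ → ℝ := fun t => A (t ^ σ)

/-- The Luxemburg functional `inf {l > 0 : ∫ A(|f(x)|/l) dx ≤ 1}`, with values in `[0, ∞]`. -/
def luxemburgNorm {n : ℕ} {F : Type*} [NormedAddCommGroup F] (A : ℝ → ℝ) (f : E n → F) : ℝ≥0∞ :=
  ⨅ (l : ℝ) (_ : 0 < l) (_ : ∫⁻ x, ENNReal.ofReal (A (‖f x‖ / l)) ≤ 1), ENNReal.ofReal l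

end RoughOrlicz

end

open MeasureTheory Filter Topology
open scoped ENNReal NNReal

noncomputable section

namespace RoughOrlicz

/-! Since `Ω` has mean zero, the kernel is orthogonal on every annulus to all radial functions. A
radial function constant on each dyadic shell, with value `c k` on `2^k ≤ |y| < 2^(k+1)`, can
therefore be subtracted from `f (x - y)` without changing any truncated integral. The regularised
integrand turns out to be absolutely integrable for almost every `x`, so the principal value exists
and is bounded by the integral of the absolute value.

On one shell, Hölder with `ρ` and its conjugate `q` leaves the `L^q` oscillation of `f` on a ball.
`exists_sobolev_poincare` controls it by the `L^s` norm of the gradient, where `1/q = 1/s - 1/n`,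
that is `s = ρn/(ρn+ρ-n)`. As `s ≤ α`, the shell contributes at most a constant times `2^k` times
the `1/α` power of the mean of `|∇f|^α` over a ball of radius `6·2^k`. This mean is bounded by the
maximal function of `|∇f|^α`, which serves for small `k`, and by the Morrey norm with decay
`2^(-βk)`, which serves for large `k`. Summing with the better bound at each scale
(`tsum_hedberg_le`) gives the pointwise estimate `exists_lintegral_roughKernel_mul_le`, with the
maximal function to the power `1/α - 1/β`.

The Orlicz bound follows from a modular inequality for the maximal operator with `B(t) =
A(t^(1/α-1/β))`. The `∇₂`-condition makes `B` superlinear, and weak type `(1,1)` with dyadic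
summation over levels suffices (`exists_lintegral_comp_maximal_le`). No convexity of `B` is used.
Since `α(1/α-1/β) = 1-α/β`, the right-hand modular is that of `A_{1-α/β}`. -/

/-! ### Weak type estimates for the maximal function. -/

/-- The centred Hardy–Littlewood maximal function of a nonnegative function. -/
def maximal {n : ℕ} (h : E n → ℝ≥0∞) (x : E n) : ℝ≥0∞ :=
  ⨆ (r : ℝ) (_ : 0 < r),
    (∫⁻ y in Metric.closedBall x r, h y) / volume (Metric.closedBall x r)

lemma volume_closedBall_eq {n : ℕ} (x : E n) {r : ℝ} (hr : 0 ≤ r) :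
    volume (Metric.closedBall x r) =
      ENNReal.ofReal (r ^ n) * volume (Metric.ball (0 : E n) 1) := by
  rw [Measure.addHaar_closedBall _ _ hr, finrank_euclideanSpace_fin]

/-- The weak type `(1, 1)` inequality for the maximal function. -/
theorem mul_volume_lt_maximal_le {n : ℕ} (hn : n ≠ 0) (h : E n → ℝ≥0∞) (t : ℝ≥0∞) :
    t * volume {x | t < maximal h x} ≤ 5 ^ n * ∫⁻ x, h x := by
  rcases eq_or_ne t 0 with rfl | ht0
  · simp
  rcases eq_or_ne t ⊤ with rfl | httop
  · simp
  rcases eq_or_ne (∫⁻ x, h x) ⊤ with hI | hI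
  · rw [hI, ENNReal.mul_top (by simp)]; exact le_top
  set S := {x | t < maximal h x} with hS
  have key : ∀ x, ∃ r : ℝ, x ∈ S → 0 < r ∧
      t * volume (Metric.closedBall x r) < ∫⁻ y in Metric.closedBall x r, h y := by
    intro x
    by_cases hx : x ∈ S
    · simp only [hS, Set.mem_ofPred_eq, maximal, lt_iSup_iff] at hx
      obtain ⟨r, hr, hlt⟩ := hx
      refine ⟨r, fun _ => ⟨hr, ?_⟩⟩
      rwa [ENNReal.lt_div_iff_mul_lt (Or.inl (Metric.measure_closedBall_pos volume x hr).ne')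
        (Or.inl measure_closedBall_lt_top.ne)] at hlt
    · exact ⟨0, fun h => absurd h hx⟩
  choose rad hrad using key
  set ω := volume (Metric.ball (0 : E n) 1) with hω
  have hω0 : ω ≠ 0 := (Metric.measure_ball_pos volume _ one_pos).ne'
  have hωt : ω ≠ ⊤ := measure_ball_lt_top.ne
  -- The Vitali covering lemma needs bounded radii. Here `t * volume (closedBall x r) ≤ ∫ h` bounds
  -- `r ^ n`, and `r ≤ r ^ n` once `r ≥ 1`.
  have hbound : ∀ x ∈ S, rad x ≤ max 1 ((∫⁻ x, h x) / (t * ω)).toReal := by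
    intro x hx
    obtain ⟨hr, hlt⟩ := hrad x hx
    by_cases h1 : rad x ≤ 1
    · exact h1.trans (le_max_left _ _)
    refine le_trans ?_ (le_max_right _ _)
    push Not at h1
    have h2 : t * volume (Metric.closedBall x (rad x)) ≤ ∫⁻ x, h x :=
      hlt.le.trans (setLIntegral_le_lintegral _ _)
    rw [volume_closedBall_eq x hr.le] at h2
    have h3 : ENNReal.ofReal (rad x ^ n) ≤ (∫⁻ x, h x) / (t * ω) := by
      rw [ENNReal.le_div_iff_mul_le (Or.inl (mul_ne_zero ht0 hω0))
        (Or.inl (ENNReal.mul_ne_top httop hωt))]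
      refine le_trans (le_of_eq ?_) h2
      ring
    have h4 : (∫⁻ x, h x) / (t * ω) ≠ ⊤ := ENNReal.div_ne_top hI (mul_ne_zero ht0 hω0)
    exact (le_self_pow₀ h1.le hn).trans ((ENNReal.ofReal_le_iff_le_toReal h4).1 h3)
  obtain ⟨u, huS, hdisj, hcov⟩ := Vitali.exists_disjoint_subfamily_covering_enlargement_closedBall
    S id rad _ hbound 5 (by norm_num)
  have hcount : u.Countable := by
    refine hdisj.countable_of_nonempty_interior fun a ha => ?_
    have := (hrad a (huS ha)).1
    exact ⟨a, mem_interior_iff_mem_nhds.2 (Metric.closedBall_mem_nhds _ this)⟩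
  have hsub : S ⊆ ⋃ b ∈ u, Metric.closedBall b (5 * rad b) := by
    intro x hx
    obtain ⟨b, hb, hsub⟩ := hcov x hx
    exact Set.mem_biUnion hb (hsub (Metric.mem_closedBall_self (hrad x hx).1.le))
  have : Countable u := hcount.to_subtype
  calc t * volume S ≤ t * ∑' b : u, volume (Metric.closedBall (b : E n) (5 * rad b)) := by
        gcongr
        exact (measure_mono hsub).trans (measure_biUnion_le _ hcount _)
    _ = ∑' b : u, 5 ^ n * (t * volume (Metric.closedBall (b : E n) (rad b))) := by
        rw [← ENNReal.tsum_mul_left]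
        congr 1; ext b
        have hr := (hrad b (huS b.2)).1.le
        rw [volume_closedBall_eq _ hr, volume_closedBall_eq _ (by positivity), mul_pow,
          ENNReal.ofReal_mul (by positivity), ENNReal.ofReal_pow (by norm_num),
          ENNReal.ofReal_ofNat]
        ring
    _ ≤ 5 ^ n * ∑' b : u, ∫⁻ y in Metric.closedBall (b : E n) (rad b), h y := by
        rw [ENNReal.tsum_mul_left]
        gcongr with b
        exact (hrad b (huS b.2)).2.le
    _ = 5 ^ n * ∫⁻ y in ⋃ b : u, Metric.closedBall (b : E n) (rad b), h y := by
        rw [lintegral_iUnion (fun b => Metric.isClosed_closedBall.measurableSet)]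
        intro a b hab
        exact hdisj a.2 b.2 (fun h => hab (Subtype.ext h))
    _ ≤ 5 ^ n * ∫⁻ x, h x := by
        gcongr
        exact Measure.restrict_le_self

/-- The weak type inequality, with only the large values of `h` on the right-hand side. -/
theorem volume_lt_maximal_le {n : ℕ} (hn : n ≠ 0) (h : E n → ℝ≥0∞) {t : ℝ} (ht : 0 < t) :
    volume {x | ENNReal.ofReal t < maximal h x} ≤
      ENNReal.ofReal (2 * 5 ^ n / t) *
        ∫⁻ x, {x | ENNReal.ofReal t < 2 * h x}.indicator h x := by
  -- Splitting at height `t/2`: the discarded part has maximal function at most `t/2`, so exceeding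
  -- `t` forces the maximal function of `h1` above `t/2`.
  set h1 := {x | ENNReal.ofReal t < 2 * h x}.indicator h with hh1
  have ht2 : ENNReal.ofReal t = ENNReal.ofReal (t / 2) + ENNReal.ofReal (t / 2) := by
    rw [← ENNReal.ofReal_add (by positivity) (by positivity), add_halves]
  have hle : ∀ x, h x ≤ h1 x + ENNReal.ofReal (t / 2) := by
    intro x
    by_cases hx : ENNReal.ofReal t < 2 * h x
    · have : h1 x = h x := Set.indicator_of_mem (s := {x | ENNReal.ofReal t < 2 * h x}) hx h
      rw [this]; exact le_self_add
    · refine le_trans ?_ le_add_self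
      push Not at hx
      rw [ENNReal.ofReal_div_of_pos two_pos, ENNReal.ofReal_ofNat,
        ENNReal.le_div_iff_mul_le (by simp) (by simp), mul_comm]
      exact hx
  have hsub : {x | ENNReal.ofReal t < maximal h x} ⊆
      {x | ENNReal.ofReal (t / 2) < maximal h1 x} := by
    intro x hx
    simp only [Set.mem_ofPred_eq] at hx ⊢
    have : maximal h x ≤ maximal h1 x + ENNReal.ofReal (t / 2) := by
      refine iSup₂_le fun r hr => ?_
      have hpos := (Metric.measure_closedBall_pos volume x hr).ne'
      have hfin : volume (Metric.closedBall x r) ≠ ⊤ := measure_closedBall_lt_top.ne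
      calc (∫⁻ y in Metric.closedBall x r, h y) / volume (Metric.closedBall x r)
          ≤ (∫⁻ y in Metric.closedBall x r, h1 y + ENNReal.ofReal (t / 2)) /
              volume (Metric.closedBall x r) := by
            gcongr with y; exact hle y
        _ = (∫⁻ y in Metric.closedBall x r, h1 y) / volume (Metric.closedBall x r) +
              ENNReal.ofReal (t / 2) := by
            rw [lintegral_add_right _ measurable_const, setLIntegral_const, ENNReal.add_div,
              ENNReal.mul_div_cancel_right hpos hfin]
        _ ≤ _ := by
            gcongr
            exact le_iSup₂_of_le (f := fun (r : ℝ) (_ : 0 < r) =>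
              (∫⁻ y in Metric.closedBall x r, h1 y) / volume (Metric.closedBall x r)) r hr le_rfl
    have h2 := hx.trans_le this
    rw [ht2] at h2
    exact lt_of_add_lt_add_right h2
  have := mul_volume_lt_maximal_le hn h1 (ENNReal.ofReal (t / 2))
  have hne : ENNReal.ofReal (t / 2) ≠ 0 := by simp [ht]
  calc volume {x | ENNReal.ofReal t < maximal h x}
      ≤ volume {x | ENNReal.ofReal (t / 2) < maximal h1 x} := measure_mono hsub
    _ ≤ (5 ^ n * ∫⁻ x, h1 x) / ENNReal.ofReal (t / 2) := by
        rw [ENNReal.le_div_iff_mul_le (Or.inl hne) (Or.inl ENNReal.ofReal_ne_top), mul_comm]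
        exact this
    _ = _ := by
        rw [show (2 * 5 ^ n / t : ℝ) = 5 ^ n / (t / 2) by field_simp,
          ENNReal.ofReal_div_of_pos (x := 5 ^ n) (half_pos ht), ENNReal.ofReal_pow (by norm_num),
          ENNReal.ofReal_ofNat, ENNReal.mul_div_right_comm]

/-! ### Two-sided geometric sums and the modular maximal inequality. -/

lemma summable_min_zpow {γ : ℝ} (hγ : 0 < γ) :
    Summable fun j : ℤ => min ((2 : ℝ) ^ (j : ℝ)) (2 ^ (-γ * j)) := by
  refine Summable.of_nat_of_neg ?_ ?_
  · refine Summable.of_nonneg_of_le (fun j => by positivity) (fun j => min_le_right _ _) ?_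
    have : (fun j : ℕ => (2 : ℝ) ^ (-γ * ((j : ℤ) : ℝ))) = fun j : ℕ => ((2 : ℝ) ^ (-γ)) ^ j := by
      ext j
      rw [Real.rpow_mul (by norm_num)]
      simp
    rw [this]
    exact summable_geometric_of_lt_one (by positivity)
      (Real.rpow_lt_one_of_one_lt_of_neg (by norm_num) (by linarith))
  · refine Summable.of_nonneg_of_le (fun j => by positivity) (fun j => min_le_left _ _) ?_
    have : (fun j : ℕ => (2 : ℝ) ^ (((-(j : ℤ) : ℤ)) : ℝ)) = fun j : ℕ => ((1 / 2 : ℝ)) ^ j := by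
      ext j
      push_cast
      rw [Real.rpow_neg (by norm_num)]
      simp
    rw [this]
    exact summable_geometric_of_lt_one (by positivity) (by norm_num)

/-- The sum `∑_{j ∈ ℤ} min(2^j, 2^{-γ j})`. -/
def twoSidedSum (γ : ℝ) : ℝ := ∑' j : ℤ, min ((2 : ℝ) ^ (j : ℝ)) (2 ^ (-γ * j))

lemma twoSidedSum_pos {γ : ℝ} (hγ : 0 < γ) : 0 < twoSidedSum γ :=
  (summable_min_zpow hγ).tsum_pos (fun j => by positivity) 0 (by positivity)

/-- Comparison with geometric decay on both sides of a pivotal scale `k₀`, uniformly in `k₀`. It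
serves both the sum over levels of the maximal function and Hedberg's sum over shells. -/
lemma tsum_le_of_le_min {γ : ℝ} (hγ : 0 < γ) (c : ℝ≥0∞) (u : ℤ → ℝ≥0∞) (k₀ : ℤ)
    (hu : ∀ j : ℤ, u (j + k₀) ≤
      c * ENNReal.ofReal (min ((2 : ℝ) ^ (j : ℝ)) (2 ^ (-γ * j)))) :
    ∑' k, u k ≤ c * ENNReal.ofReal (twoSidedSum γ) := by
  rw [← (Equiv.addRight k₀).tsum_eq u, twoSidedSum,
    ENNReal.ofReal_tsum_of_nonneg (fun j => by positivity) (summable_min_zpow hγ),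
    ← ENNReal.tsum_mul_left]
  exact ENNReal.tsum_le_tsum hu

/-- The argument grows by `K ^ m` but the value by `(2 * K) ^ m`; the surplus `2 ^ m` over linear
growth makes the sum over levels converge. -/
lemma nabla2_iterate {B : ℝ → ℝ} {K : ℝ} (hK : 1 < K)
    (h : ∀ r, 0 ≤ r → B r ≤ 1 / (2 * K) * B (K * r)) (m : ℕ) {r : ℝ} (hr : 0 ≤ r) :
    (2 * K) ^ m * B r ≤ B (K ^ m * r) := by
  have hK0 : 0 < K := by linarith
  induction m with
  | zero => simp
  | succ m ih =>
    have := h (K ^ m * r) (by positivity)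
    rw [one_div, inv_mul_eq_div, le_div_iff₀ (by positivity)] at this
    calc (2 * K) ^ (m + 1) * B r = ((2 * K) ^ m * B r) * (2 * K) := by ring
      _ ≤ B (K ^ m * r) * (2 * K) := by gcongr
      _ ≤ B (K * (K ^ m * r)) := this
      _ = _ := by congr 1; ring

/-- The dyadic sum which replaces the Stieltjes integral `∫₀^{2s} dB(t) / t`. -/
lemma tsum_nabla2_le {B : ℝ → ℝ} (hmono : MonotoneOn B (Set.Ici 0)) (h0 : 0 ≤ B 0)
    {K : ℝ} (hK : 1 < K) (h : ∀ r, 0 ≤ r → B r ≤ 1 / (2 * K) * B (K * r))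
    {s : ℝ} (hs : 0 ≤ s) :
    ∑' j : ℤ, ENNReal.ofReal (B (K ^ (j + 1))) * (ENNReal.ofReal (1 / K ^ j) *
        (if K ^ j < 2 * s then ENNReal.ofReal s else 0)) ≤
      ENNReal.ofReal (B (2 * K * s)) * ENNReal.ofReal (K * twoSidedSum 1) := by
  have hK0 : 0 < K := by linarith
  have hBnn : ∀ t, 0 ≤ t → 0 ≤ B t := fun t ht => h0.trans (hmono (by simp) ht ht)
  rcases hs.eq_or_lt with rfl | hs
  · simp
  -- With `K^J < 2s ≤ K^(J+1)`, only levels `j = J - m` with `m ≥ 0` contribute, and iterating `∇₂`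
  -- makes the `m`-th one smaller by `2^(-m)`.
  obtain ⟨J, hJ1, hJ2⟩ := exists_mem_Ioc_zpow (show 0 < 2 * s by positivity) hK
  have hBK := hBnn (2 * K * s) (by positivity)
  rw [ENNReal.ofReal_mul hK0.le, ← mul_assoc]
  refine tsum_le_of_le_min one_pos _ _ J fun i => ?_
  rw [← ENNReal.ofReal_mul hBK, ← ENNReal.ofReal_mul (by positivity)]
  split_ifs with hi
  swap
  · simp
  rw [← ENNReal.ofReal_mul (by positivity), ← ENNReal.ofReal_mul (hBnn _ (by positivity))]
  apply ENNReal.ofReal_le_ofReal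
  have hi0 : i ≤ 0 := by
    have := hi.trans_le hJ2
    rw [zpow_lt_zpow_iff_right₀ hK] at this
    omega
  obtain ⟨m, rfl⟩ : ∃ m : ℕ, i = -m := ⟨i.natAbs, by omega⟩
  have hmin : min ((2 : ℝ) ^ ((-m : ℤ) : ℝ)) (2 ^ (-1 * ((-m : ℤ) : ℝ))) = 1 / 2 ^ m := by
    rw [min_eq_left]
    · push_cast
      rw [Real.rpow_neg (by norm_num)]
      simp
    · apply Real.rpow_le_rpow_of_exponent_le (by norm_num)
      push_cast
      have : (0 : ℝ) ≤ m := by positivity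
      linarith
  rw [hmin]
  have hit := nabla2_iterate hK h m (r := K ^ (-m + J + 1 : ℤ)) (by positivity)
  rw [← zpow_natCast K m, ← zpow_add₀ hK0.ne'] at hit
  have e : (m : ℤ) + (-m + J + 1) = J + 1 := by ring
  rw [e] at hit
  have hJB : B (K ^ (J + 1)) ≤ B (2 * K * s) := by
    refine hmono (by simp; positivity) (by simp; positivity) ?_
    rw [zpow_add_one₀ hK0.ne']
    nlinarith
  have hKJ : s ≤ K ^ J * K := by
    rw [zpow_add_one₀ hK0.ne'] at hJ2
    linarith
  have e2 : K ^ (-m + J : ℤ) = K ^ J / K ^ m := by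
    rw [add_comm, ← sub_eq_add_neg, zpow_sub₀ hK0.ne', zpow_natCast]
  have hb : (2 * K) ^ m * B (K ^ (-m + J + 1 : ℤ)) ≤ B (2 * K * s) := hit.trans hJB
  rw [e2]
  have hb2 : B (K ^ (-m + J + 1 : ℤ)) ≤ B (2 * K * s) / (2 * K) ^ m := by
    rw [le_div_iff₀ (by positivity)]; linarith
  calc B (K ^ (-m + J + 1 : ℤ)) * (1 / (K ^ J / K ^ m) * s)
      ≤ B (2 * K * s) / (2 * K) ^ m * (1 / (K ^ J / K ^ m) * (K ^ J * K)) := by gcongr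
    _ = _ := by
      rw [mul_pow]
      field_simp

/-- A substitute for the layer-cake formula: the single level with `K^J < m ≤ K^(J+1)` already
dominates, so only the monotonicity of `B` is needed. -/
lemma le_tsum_levels {B : ℝ → ℝ} (hmono : MonotoneOn B (Set.Ici 0)) (h0 : B 0 = 0)
    {K : ℝ} (hK : 1 < K) {m : ℝ≥0∞} (hm : m ≠ ⊤) :
    ENNReal.ofReal (B m.toReal) ≤
      ∑' j : ℤ, ENNReal.ofReal (B (K ^ (j + 1))) *
        (if ENNReal.ofReal (K ^ j) < m then 1 else 0) := by
  have hK0 : 0 < K := by linarith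
  rcases eq_or_ne m 0 with rfl | hm0
  · simp [h0]
  obtain ⟨J, hJ1, hJ2⟩ := exists_mem_Ioc_zpow (ENNReal.toReal_pos hm0 hm) hK
  refine le_trans ?_ (ENNReal.le_tsum J)
  rw [if_pos, mul_one]
  · exact ENNReal.ofReal_le_ofReal (hmono (by simp) (by simp; positivity) hJ2)
  · rwa [ENNReal.ofReal_lt_iff_lt_toReal (by positivity) hm]

/-- The modular maximal inequality under the `∇₂`-condition. -/
theorem exists_lintegral_comp_maximal_le {n : ℕ} (hn : n ≠ 0) {B : ℝ → ℝ}
    (hmono : MonotoneOn B (Set.Ici 0)) (h0 : B 0 = 0) (hB : Nabla2 B) :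
    ∃ c : ℝ, 0 < c ∧ ∀ h : E n → ℝ, AEMeasurable h → (∀ x, 0 ≤ h x) →
      (∀ᵐ x, maximal (fun y => ENNReal.ofReal (h y)) x < ⊤) →
      ∫⁻ x, ENNReal.ofReal (B (maximal (fun y => ENNReal.ofReal (h y)) x).toReal) ≤
        ∫⁻ x, ENNReal.ofReal (B (c * h x)) := by
  obtain ⟨K, hK, hKB⟩ := hB
  have hK0 : 0 < K := by linarith
  have hBnn : ∀ t, 0 ≤ t → 0 ≤ B t := fun t ht => h0.symm.le.trans (hmono (by simp) ht ht)
  set D : ℝ := 2 * 5 ^ n with hD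
  set C : ℝ := D * (K * twoSidedSum 1) with hC
  have hT := twoSidedSum_pos one_pos
  -- The multiplicative constant `C` is moved inside `B`: once `(2K)^N > C`, iterated `∇₂` gives `C
  -- * B r ≤ B (K^N * r)`.
  obtain ⟨N, hN⟩ := pow_unbounded_of_one_lt C (show 1 < 2 * K by linarith)
  refine ⟨K ^ N * (2 * K), by positivity, fun h hm hnn hfin => ?_⟩
  set H : E n → ℝ≥0∞ := fun y => ENNReal.ofReal (h y) with hH
  have hHm : AEMeasurable H := hm.ennreal_ofReal
  -- Measurability of these level sets is never required: they are replaced by measurable hulls of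
  -- the same measure.
  set S : ℤ → Set (E n) := fun j => {x | ENNReal.ofReal (K ^ j) < maximal H x} with hS
  have hstep : ∀ j : ℤ, volume (S j) ≤ ENNReal.ofReal D *
      ∫⁻ x, ENNReal.ofReal (1 / K ^ j) * (if K ^ j < 2 * h x then H x else 0) := by
    intro j
    refine (volume_lt_maximal_le hn H (zpow_pos hK0 j)).trans (le_of_eq ?_)
    rw [lintegral_const_mul' _ _ ENNReal.ofReal_ne_top, ← mul_assoc,
      ← ENNReal.ofReal_mul (by positivity), mul_one_div]
    congr 1
    refine lintegral_congr fun x => ?_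
    have : (ENNReal.ofReal (K ^ j) < 2 * H x) ↔ K ^ j < 2 * h x := by
      rw [hH, ← ENNReal.ofReal_ofNat 2, ← ENNReal.ofReal_mul (by norm_num),
        ENNReal.ofReal_lt_ofReal_iff_of_nonneg (by positivity)]
    rw [Set.indicator_apply]
    simp only [Set.mem_ofPred_eq, this]
  calc ∫⁻ x, ENNReal.ofReal (B (maximal H x).toReal)
      ≤ ∫⁻ x, ∑' j : ℤ, ENNReal.ofReal (B (K ^ (j + 1))) *
          (toMeasurable volume (S j)).indicator 1 x := by
        refine lintegral_mono_ae (hfin.mono fun x hx => ?_)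
        refine (le_tsum_levels hmono h0 hK hx.ne).trans (ENNReal.tsum_le_tsum fun j => ?_)
        gcongr
        split_ifs with hj
        · have hj' : x ∈ S j := hj
          rw [Set.indicator_of_mem (subset_toMeasurable volume (S j) hj')]; simp
        · exact zero_le
    _ = ∑' j : ℤ, ENNReal.ofReal (B (K ^ (j + 1))) * volume (S j) := by
        rw [lintegral_tsum]
        · congr 1; ext j
          rw [lintegral_const_mul' _ _ ENNReal.ofReal_ne_top,
            lintegral_indicator_one (measurableSet_toMeasurable _ _), measure_toMeasurable]
        · intro j
          exact ((measurable_one.indicator (measurableSet_toMeasurable _ _)).const_mul _).aemeasurable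
    _ ≤ ∑' j : ℤ, ENNReal.ofReal (B (K ^ (j + 1))) * (ENNReal.ofReal D *
      ∫⁻ x, ENNReal.ofReal (1 / K ^ j) * (if K ^ j < 2 * h x then H x else 0)) := by
        gcongr with j; exact hstep j
    _ = ENNReal.ofReal D * ∫⁻ x, ∑' j : ℤ, ENNReal.ofReal (B (K ^ (j + 1))) *
          (ENNReal.ofReal (1 / K ^ j) * (if K ^ j < 2 * h x then H x else 0)) := by
        rw [lintegral_tsum, ← ENNReal.tsum_mul_left]
        · congr 1; ext j
          rw [mul_left_comm]
          congr 1
          exact (lintegral_const_mul' _ _ ENNReal.ofReal_ne_top).symm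
        · intro j
          refine ((AEMeasurable.const_mul ?_ _)).const_mul _
          have := hHm.indicator₀ (s := {x | K ^ j < 2 * h x})
            (nullMeasurableSet_lt aemeasurable_const (hm.const_mul 2))
          refine this.congr (ae_of_all _ fun x => ?_)
          rw [Set.indicator_apply]
          simp only [Set.mem_ofPred_eq]
    _ ≤ ENNReal.ofReal D * ∫⁻ x, ENNReal.ofReal (B (2 * K * h x)) *
          ENNReal.ofReal (K * twoSidedSum 1) := by
        gcongr with x
        exact tsum_nabla2_le hmono h0.symm.le hK hKB (hnn x)
    _ = ∫⁻ x, ENNReal.ofReal (C * B (2 * K * h x)) := by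
        rw [lintegral_mul_const' _ _ ENNReal.ofReal_ne_top, mul_comm, mul_assoc,
          ← ENNReal.ofReal_mul (by positivity), ← lintegral_mul_const' _ _ ENNReal.ofReal_ne_top]
        refine lintegral_congr fun x => ?_
        rw [← ENNReal.ofReal_mul (hBnn _ (mul_nonneg (by positivity) (hnn x))), hC]
        congr 1; ring
    _ ≤ ∫⁻ x, ENNReal.ofReal (B (K ^ N * (2 * K) * h x)) := by
        gcongr with x
        have hx : 0 ≤ 2 * K * h x := mul_nonneg (by positivity) (hnn x)
        have := nabla2_iterate hK hKB N hx
        rw [← mul_assoc] at this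
        exact (mul_le_mul_of_nonneg_right hN.le (hBnn _ hx)).trans this

/-! ### Poincaré and Sobolev–Poincaré inequalities for `C¹` functions. -/

/-- Jensen's inequality for a sub-probability density `w`. -/
lemma lintegral_mul_rpow_le {X : Type*} [MeasurableSpace X] {μ : Measure X} {w G : X → ℝ≥0∞}
    (hw : AEMeasurable w μ) (hG : AEMeasurable G μ) (h1 : ∫⁻ x, w x ∂μ ≤ 1) {s : ℝ} (hs : 1 < s) :
    (∫⁻ x, w x * G x ∂μ) ^ s ≤ ∫⁻ x, w x * G x ^ s ∂μ := by
  have hs0 : 0 < s := by linarith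
  have hpq := Real.HolderConjugate.conjExponent hs
  set q := s.conjExponent
  -- Hölder applied to `w * G = (w^(1/s) * G) * w^(1/q)`; the last factor has norm at most one.
  have key := ENNReal.lintegral_mul_le_Lp_mul_Lq μ hpq (f := fun x => w x ^ (1 / s) * G x)
    (g := fun x => w x ^ (1 / q)) ((hw.pow_const _).mul hG) (hw.pow_const _)
  have e1 : ∀ x, ((fun x => w x ^ (1 / s) * G x) * fun x => w x ^ (1 / q)) x = w x * G x := by
    intro x
    have := hpq.inv_add_inv_eq_one
    simp only [Pi.mul_apply]
    rw [mul_right_comm, ← ENNReal.rpow_add_of_nonneg _ _ (by positivity)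
      (one_div_nonneg.2 hpq.symm.nonneg), one_div, one_div, this, ENNReal.rpow_one]
  have e2 : ∀ x, (w x ^ (1 / s) * G x) ^ s = w x * G x ^ s := by
    intro x
    rw [ENNReal.mul_rpow_of_nonneg _ _ hs0.le, ← ENNReal.rpow_mul, one_div_mul_cancel hs0.ne',
      ENNReal.rpow_one]
  have e3 : ∀ x, (w x ^ (1 / q)) ^ q = w x := by
    intro x
    rw [← ENNReal.rpow_mul, one_div_mul_cancel hpq.symm.ne_zero, ENNReal.rpow_one]
  simp only [e1, e2, e3] at key
  have key2 : ∫⁻ x, w x * G x ∂μ ≤ (∫⁻ x, w x * G x ^ s ∂μ) ^ (1 / s) := by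
    refine key.trans (mul_le_of_le_one_right' ?_)
    exact ENNReal.rpow_le_one h1 (one_div_nonneg.2 hpq.symm.nonneg)
  calc _ ≤ ((∫⁻ x, w x * G x ^ s ∂μ) ^ (1 / s)) ^ s := by gcongr
    _ = _ := by rw [← ENNReal.rpow_mul, one_div_mul_cancel hs0.ne', ENNReal.rpow_one]

lemma enorm_sub_le_lintegral_segment {n : ℕ} {u : E n → ℝ} (hu : ContDiff ℝ 1 u) (x y : E n) :
    ‖u x - u y‖ₑ ≤ ‖x - y‖ₑ *
      ∫⁻ t in Set.Ioc (0 : ℝ) 1, ‖fderiv ℝ u (y + t • (x - y))‖ₑ := by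
  have hd : ∀ t : ℝ, HasDerivAt (fun t : ℝ => u (y + t • (x - y)))
      (fderiv ℝ u (y + t • (x - y)) (x - y)) t := by
    intro t
    have h1 : HasDerivAt (fun t : ℝ => y + t • (x - y)) (x - y) t := by
      simpa using ((hasDerivAt_id t).smul_const (x - y)).const_add y
    exact ((hu.differentiable one_ne_zero _).hasFDerivAt).comp_hasDerivAt t h1
  have hc : Continuous fun t : ℝ => fderiv ℝ u (y + t • (x - y)) (x - y) :=
    ((hu.continuous_fderiv one_ne_zero).comp (by fun_prop)).clm_apply continuous_const
  have h := intervalIntegral.integral_eq_sub_of_hasDerivAt (a := 0) (b := 1)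
    (fun t _ => hd t) (hc.intervalIntegrable _ _)
  simp only [one_smul, zero_smul, add_zero, add_sub_cancel] at h
  rw [← h, intervalIntegral.integral_of_le zero_le_one,
    ← lintegral_const_mul' _ _ enorm_ne_top]
  refine (enorm_integral_le_lintegral_enorm _).trans (lintegral_mono fun t => ?_)
  rw [mul_comm]
  exact ContinuousLinearMap.le_opENorm _ _

lemma lintegral_comp_smul_add {n : ℕ} {F : E n → ℝ≥0∞} (hF : Measurable F) {t : ℝ} (ht : 0 < t)
    (c : E n) : ∫⁻ x, F (t • x + c) = ENNReal.ofReal ((t ^ n)⁻¹) * ∫⁻ x, F x := by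
  have h1 : ∫⁻ x, F (t • x + c) = ∫⁻ z, F (z + c) ∂(Measure.map (t • ·) volume) := by
    exact (lintegral_map (hF.comp (measurable_add_const c)) (measurable_const_smul t)).symm
  rw [h1, Measure.map_addHaar_smul _ ht.ne', lintegral_smul_measure, finrank_euclideanSpace_fin,
    lintegral_add_right_eq_self, abs_of_pos (by positivity), smul_eq_mul]

/-- The contraction towards `y` maps the convex set into itself with Jacobian `t ^ n ≥ 2 ^ (-n)`.
The restriction `t ≥ 1/2` keeps this constant uniform. -/
lemma setLIntegral_segment_le {n : ℕ} {G : E n → ℝ≥0∞} (hG : Measurable G) {B : Set (E n)}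
    (hB : MeasurableSet B) (hconv : Convex ℝ B) {t : ℝ} (ht : 1 / 2 ≤ t) (ht1 : t ≤ 1)
    {y : E n} (hy : y ∈ B) :
    ∫⁻ x in B, G (y + t • (x - y)) ≤ 2 ^ n * ∫⁻ x in B, G x := by
  have ht0 : 0 < t := by linarith
  calc ∫⁻ x in B, G (y + t • (x - y)) ≤ ∫⁻ x in B, B.indicator G (t • x + (1 - t) • y) := by
        refine setLIntegral_mono' hB fun x hx => ?_
        have e : y + t • (x - y) = t • x + (1 - t) • y := by module
        rw [e, Set.indicator_of_mem]
        exact hconv hx hy ht0.le (by linarith) (by ring)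
    _ ≤ ∫⁻ x, B.indicator G (t • x + (1 - t) • y) := setLIntegral_le_lintegral _ _
    _ = ENNReal.ofReal ((t ^ n)⁻¹) * ∫⁻ x in B, G x := by
        rw [lintegral_comp_smul_add (hG.indicator hB) ht0, lintegral_indicator hB]
    _ ≤ _ := by
        gcongr
        rw [← ENNReal.ofReal_ofNat, ← ENNReal.ofReal_pow (by norm_num)]
        apply ENNReal.ofReal_le_ofReal
        rw [← inv_pow]
        gcongr
        rw [inv_le_comm₀ ht0 (by norm_num)]
        linarith

/-- Exchanging `x` and `y` turns `t` into `1 - t`, and one of the two is at least `1/2`. -/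
lemma lintegral_lintegral_segment_le {n : ℕ} {G : E n → ℝ≥0∞} (hG : Measurable G)
    {B : Set (E n)} (hB : MeasurableSet B) (hconv : Convex ℝ B) {t : ℝ} (ht : 0 ≤ t)
    (ht1 : t ≤ 1) :
    ∫⁻ y in B, ∫⁻ x in B, G (y + t • (x - y)) ≤ 2 ^ n * volume B * ∫⁻ x in B, G x := by
  have key : ∀ t : ℝ, 1 / 2 ≤ t → t ≤ 1 →
      ∫⁻ y in B, ∫⁻ x in B, G (y + t • (x - y)) ≤ 2 ^ n * volume B * ∫⁻ x in B, G x := by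
    intro t ht ht1
    refine (setLIntegral_mono' hB fun y hy =>
      setLIntegral_segment_le hG hB hconv ht ht1 hy).trans (le_of_eq ?_)
    rw [setLIntegral_const]
    ring
  rcases le_total (1 / 2) t with h | h
  · exact key t h ht1
  · rw [lintegral_lintegral_swap]
    · refine le_trans (le_of_eq ?_) (key (1 - t) (by linarith) (by linarith))
      refine lintegral_congr fun x => lintegral_congr fun y => ?_
      congr 1
      module
    · exact (hG.comp (by fun_prop)).aemeasurable

/-- The Poincaré inequality on balls, in double integral form. -/
theorem lintegral_lintegral_sub_rpow_le {n : ℕ} {u : E n → ℝ} (hu : ContDiff ℝ 1 u)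
    {s : ℝ} (hs : 1 < s) (x₀ : E n) (r : ℝ) :
    ∫⁻ y in Metric.ball x₀ r, ∫⁻ x in Metric.ball x₀ r, ‖u x - u y‖ₑ ^ s ≤
      volume (Metric.ball x₀ r) * (ENNReal.ofReal (2 * r) ^ s *
        (2 ^ n * ∫⁻ x in Metric.ball x₀ r, ‖fderiv ℝ u x‖ₑ ^ s)) := by
  set B := Metric.ball x₀ r
  have hs0 : 0 < s := by linarith
  have hB : MeasurableSet B := Metric.isOpen_ball.measurableSet
  have hcont : Continuous fun x => ‖fderiv ℝ u x‖ₑ ^ s :=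
    ENNReal.continuous_rpow_const.comp (hu.continuous_fderiv one_ne_zero).enorm
  set G : E n → ℝ≥0∞ := fun x => ‖fderiv ℝ u x‖ₑ ^ s with hG
  have hGm : Measurable G := hcont.measurable
  have hpt : ∀ y ∈ B, ∀ x ∈ B, ‖u x - u y‖ₑ ^ s ≤
      ENNReal.ofReal (2 * r) ^ s * ∫⁻ t in Set.Ioc (0 : ℝ) 1, G (y + t • (x - y)) := by
    intro y hy x hx
    have hxy : ‖x - y‖ₑ ≤ ENNReal.ofReal (2 * r) := by
      rw [← ofReal_norm]
      apply ENNReal.ofReal_le_ofReal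
      rw [← dist_eq_norm]
      have := dist_triangle_right x y x₀
      simp only [B, Metric.mem_ball] at hx hy
      linarith
    have hm : Measurable fun t : ℝ => ‖fderiv ℝ u (y + t • (x - y))‖ₑ :=
      ((hu.continuous_fderiv one_ne_zero).comp (by fun_prop)).enorm.measurable
    have hJ := lintegral_mul_rpow_le (μ := volume.restrict (Set.Ioc (0 : ℝ) 1)) (w := fun _ => 1)
      (G := fun t : ℝ => ‖fderiv ℝ u (y + t • (x - y))‖ₑ) aemeasurable_const
      hm.aemeasurable (by simp) hs
    simp only [one_mul] at hJ
    calc ‖u x - u y‖ₑ ^ s ≤ (‖x - y‖ₑ *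
        ∫⁻ t in Set.Ioc (0 : ℝ) 1, ‖fderiv ℝ u (y + t • (x - y))‖ₑ) ^ s := by
          gcongr; exact enorm_sub_le_lintegral_segment hu x y
      _ ≤ _ := by
          rw [ENNReal.mul_rpow_of_nonneg _ _ hs0.le]
          gcongr
  have hjm : ∀ y : E n, AEMeasurable (Function.uncurry fun (x : E n) (t : ℝ) =>
      G (y + t • (x - y))) ((volume.restrict B).prod (volume.restrict (Set.Ioc (0 : ℝ) 1))) :=
    fun y => (hGm.comp (by fun_prop)).aemeasurable
  have hjm2 : Measurable (Function.uncurry fun (y : E n) (t : ℝ) =>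
      ∫⁻ x in B, G (y + t • (x - y))) := by
    have : Measurable fun q : (E n × ℝ) × E n => G (q.1.1 + q.1.2 • (q.2 - q.1.1)) :=
      hGm.comp (by fun_prop)
    exact this.lintegral_prod_right'
  calc ∫⁻ y in B, ∫⁻ x in B, ‖u x - u y‖ₑ ^ s
      ≤ ∫⁻ y in B, ∫⁻ x in B, ENNReal.ofReal (2 * r) ^ s *
          ∫⁻ t in Set.Ioc (0 : ℝ) 1, G (y + t • (x - y)) :=
        setLIntegral_mono' hB fun y hy => setLIntegral_mono' hB fun x hx => hpt y hy x hx
    _ = ENNReal.ofReal (2 * r) ^ s * ∫⁻ t in Set.Ioc (0 : ℝ) 1, ∫⁻ y in B, ∫⁻ x in B,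
          G (y + t • (x - y)) := by
        have hc : ENNReal.ofReal (2 * r) ^ s ≠ ⊤ :=
          ENNReal.rpow_ne_top_of_nonneg hs0.le ENNReal.ofReal_ne_top
        simp_rw [lintegral_const_mul' _ _ hc]
        congr 1
        rw [lintegral_lintegral_swap (μ := volume.restrict (Set.Ioc (0 : ℝ) 1))]
        · exact lintegral_congr fun y => lintegral_lintegral_swap (hjm y)
        · exact (hjm2.comp measurable_swap).aemeasurable
    _ ≤ ENNReal.ofReal (2 * r) ^ s * ∫⁻ t in Set.Ioc (0 : ℝ) 1,
          2 ^ n * volume B * ∫⁻ x in B, G x := by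
        refine mul_le_mul' le_rfl ?_
        refine setLIntegral_mono' measurableSet_Ioc fun t ht => ?_
        exact lintegral_lintegral_segment_le hGm hB (convex_ball x₀ r) ht.1.le ht.2
    _ = _ := by
        rw [setLIntegral_const]
        simp
        ring

/-- The Gagliardo–Nirenberg–Sobolev inequality, with Lebesgue integrals in place of norms. -/
lemma exists_gagliardo_nirenberg {n : ℕ} (hn : n ≠ 0) {s p : ℝ} (hs : 1 < s) (hp : 0 < p)
    (hsp : 1 / p = 1 / s - 1 / n) :
    ∃ C : ℝ≥0, ∀ v : E n → ℝ, ContDiff ℝ 1 v → HasCompactSupport v →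
      (∫⁻ x, ‖v x‖ₑ ^ p) ^ (1 / p) ≤ C * (∫⁻ x, ‖fderiv ℝ v x‖ₑ ^ s) ^ (1 / s) := by
  lift s to ℝ≥0 using by linarith
  lift p to ℝ≥0 using hp.le
  refine ⟨SNormLESNormFDerivOfEqConst ℝ (volume : Measure (E n)) s, fun v hv hc => ?_⟩
  have key := eLpNorm_le_eLpNorm_fderiv_of_eq (volume : Measure (E n)) hv hc
    (p := s) (p' := p) (by exact_mod_cast hs.le)
    (by rw [finrank_euclideanSpace_fin]; omega)
    (by rw [finrank_euclideanSpace_fin]; simpa using hsp)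
  have hs0 : s ≠ 0 := by rintro rfl; norm_num at hs
  have hp0 : p ≠ 0 := by rintro rfl; simp at hp
  rwa [eLpNorm_nnreal_eq_lintegral hp0, eLpNorm_nnreal_eq_lintegral hs0] at key

/-- The constant is a value `u y`, at a point `y` where the inner integral of the double Poincaré
inequality does not exceed its average. The mean of `u` is never needed. -/
lemma exists_lintegral_sub_const_rpow_le {n : ℕ} {u : E n → ℝ} (hu : ContDiff ℝ 1 u)
    {s : ℝ} (hs : 1 < s) (x₀ : E n) {r : ℝ} (hr : 0 < r) :
    ∃ c : ℝ, (∫⁻ x in Metric.ball x₀ r, ‖u x - c‖ₑ ^ s) ^ (1 / s) ≤ ENNReal.ofReal (2 * r) *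
      ((2 ^ n) ^ (1 / s) * (∫⁻ x in Metric.ball x₀ r, ‖fderiv ℝ u x‖ₑ ^ s) ^ (1 / s)) := by
  have hs0 : 0 < s := by linarith
  have h := lintegral_lintegral_sub_rpow_le hu hs x₀ r
  have hpos : volume (Metric.ball x₀ r) ≠ 0 := (Metric.measure_ball_pos volume _ hr).ne'
  have hfin : volume (Metric.ball x₀ r) ≠ ⊤ := measure_ball_lt_top.ne
  have hm : Measurable fun q : E n × E n => ‖u q.2 - u q.1‖ₑ ^ s :=
    (((hu.continuous.comp continuous_snd).sub (hu.continuous.comp continuous_fst)).enorm.measurable).pow_const _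
  obtain ⟨y, -, hy⟩ := exists_le_setLAverage hpos hfin
    (f := fun y => ∫⁻ x in Metric.ball x₀ r, ‖u x - u y‖ₑ ^ s)
    (hm.lintegral_prod_right').aemeasurable
  refine ⟨u y, ?_⟩
  rw [setLAverage_eq] at hy
  have h2 := hy.trans (ENNReal.div_le_of_le_mul' h)
  calc _ ≤ _ := ENNReal.rpow_le_rpow h2 (by positivity)
    _ = _ := by
      rw [ENNReal.mul_rpow_of_nonneg _ _ (by positivity),
        ENNReal.mul_rpow_of_nonneg _ _ (by positivity), ← ENNReal.rpow_mul,
        mul_one_div_cancel hs0.ne', ENNReal.rpow_one]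

/-- The Sobolev–Poincaré inequality on balls for continuously differentiable functions. -/
theorem exists_sobolev_poincare_of_contDiff {n : ℕ} (hn : n ≠ 0) {s p : ℝ} (hs : 1 < s)
    (hp : 0 < p) (hsp : 1 / p = 1 / s - 1 / n) :
    ∃ C : ℝ≥0, ∀ u : E n → ℝ, ContDiff ℝ 1 u → ∀ (x₀ : E n) (r : ℝ), 0 < r → ∃ c : ℝ,
      (∫⁻ x in Metric.ball x₀ r, ‖u x - c‖ₑ ^ p) ^ (1 / p) ≤
        C * (∫⁻ x in Metric.ball x₀ (2 * r), ‖fderiv ℝ u x‖ₑ ^ s) ^ (1 / s) := by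
  have hs0 : 0 < s := by linarith
  obtain ⟨C, hC⟩ := exists_gagliardo_nirenberg hn hs hp hsp
  -- The cutoff is one on the unit ball and supported in radius `3/2 < 2`; after rescaling, the
  -- support of `η ∘ ψ` lies inside `B`.
  let η : ContDiffBump (0 : E n) := ⟨1, 3 / 2, by norm_num, by norm_num⟩
  have hη : ContDiff ℝ 1 (η : E n → ℝ) := η.contDiff
  obtain ⟨M, hM⟩ := (hη.continuous_fderiv one_ne_zero).bounded_above_of_compact_support
    (η.hasCompactSupport.fderiv ℝ)
  have hM0 : 0 ≤ M := (norm_nonneg _).trans (hM 0)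
  -- The product rule costs `M / r` on the term `u - c`, and Poincaré on the ball of radius `2r`
  -- returns `2 * (2 * r)`. The product `4 * M` does not depend on `r`.
  set L : ℝ≥0∞ := C * (1 + ENNReal.ofReal (4 * M) * (2 ^ n) ^ (1 / s)) with hL
  have hLt : L ≠ ⊤ := by
    rw [hL]
    refine ENNReal.mul_ne_top ENNReal.coe_ne_top (ENNReal.add_ne_top.2 ⟨by simp, ?_⟩)
    exact ENNReal.mul_ne_top ENNReal.ofReal_ne_top
      (ENNReal.rpow_ne_top_of_nonneg (by positivity) (by simp))
  refine ⟨L.toNNReal, fun u hu x₀ r hr => ?_⟩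
  rw [ENNReal.coe_toNNReal hLt]
  obtain ⟨c, hc⟩ := exists_lintegral_sub_const_rpow_le hu hs x₀ (show 0 < 2 * r by positivity)
  refine ⟨c, ?_⟩
  set B := Metric.ball x₀ (2 * r)
  have hB : MeasurableSet B := Metric.isOpen_ball.measurableSet
  set ψ : E n → E n := fun x => r⁻¹ • (x - x₀) with hψ
  have hψn : ∀ x, ‖ψ x‖ = dist x x₀ / r := fun x => by
    rw [hψ, norm_smul, norm_inv, Real.norm_of_nonneg hr.le, dist_eq_norm, inv_mul_eq_div]
  set v : E n → ℝ := fun x => η (ψ x) * (u x - c) with hv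
  have hψd : ∀ x, HasFDerivAt ψ (r⁻¹ • ContinuousLinearMap.id ℝ (E n)) x := fun x =>
    ((hasFDerivAt_id x).sub_const x₀).const_smul r⁻¹
  have hψc : ContDiff ℝ 1 ψ := by fun_prop
  have hvc : ContDiff ℝ 1 v := (hη.comp hψc).mul (hu.sub contDiff_const)
  have hout : ∀ x, x ∉ B → ψ x ∉ tsupport (η : E n → ℝ) := by
    intro x hx hx'
    rw [η.tsupport_eq, mem_closedBall_zero_iff, hψn, div_le_iff₀ hr] at hx'
    simp only [B, Metric.mem_ball, not_lt] at hx
    have : η.rOut = 3 / 2 := rfl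
    rw [this] at hx'
    linarith
  have hvs : HasCompactSupport v := by
    refine HasCompactSupport.intro (isCompact_closedBall x₀ (2 * r)) fun x hx => ?_
    have := hout x fun h => hx (Metric.ball_subset_closedBall h)
    simp only [hv, image_eq_zero_of_notMem_tsupport this, zero_mul]
  have hvd : ∀ x, ‖fderiv ℝ v x‖ₑ ≤ B.indicator
      (fun x => ‖fderiv ℝ u x‖ₑ + ENNReal.ofReal (M / r) * ‖u x - c‖ₑ) x := by
    intro x
    have h1 : HasFDerivAt (fun x => η (ψ x))
        ((fderiv ℝ η (ψ x)).comp (r⁻¹ • ContinuousLinearMap.id ℝ (E n))) x :=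
      ((hη.differentiable one_ne_zero _).hasFDerivAt).comp x (hψd x)
    have h2 : HasFDerivAt (fun x => u x - c) (fderiv ℝ u x) x :=
      ((hu.differentiable one_ne_zero x).hasFDerivAt).sub_const c
    have h3 := (h1.mul h2).fderiv
    change fderiv ℝ v x = _ at h3
    by_cases hx : x ∈ B
    · rw [Set.indicator_of_mem hx, h3]
      refine (enorm_add_le (η (ψ x) • fderiv ℝ u x) _).trans (add_le_add ?_ ?_)
      · rw [enorm_smul]
        refine mul_le_of_le_one_left' ?_
        rw [← ofReal_norm, ENNReal.ofReal_le_one, Real.norm_of_nonneg η.nonneg]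
        exact η.le_one
      · rw [enorm_smul, mul_comm]
        gcongr
        rw [← ofReal_norm]
        apply ENNReal.ofReal_le_ofReal
        rw [ContinuousLinearMap.comp_smul, ContinuousLinearMap.comp_id, norm_smul, norm_inv,
          Real.norm_of_nonneg hr.le, inv_mul_eq_div]
        gcongr
        exact hM _
    · have h0 : fderiv ℝ v x = 0 := by
        rw [h3, image_eq_zero_of_notMem_tsupport (hout x hx),
          fderiv_of_notMem_tsupport ℝ (hout x hx)]
        simp
      rw [h0, ← ofReal_norm, norm_zero, ENNReal.ofReal_zero]
      exact zero_le
  have hball : ∀ x ∈ Metric.ball x₀ r, u x - c = v x := by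
    intro x hx
    have : η (ψ x) = 1 := by
      refine η.one_of_mem_closedBall ?_
      rw [mem_closedBall_zero_iff, hψn]
      exact (div_le_one hr).2 (Metric.mem_ball.1 hx).le
    simp [hv, this]
  have hm1 : Measurable fun x => ‖fderiv ℝ u x‖ₑ :=
    (hu.continuous_fderiv one_ne_zero).enorm.measurable
  have hm2 : Measurable fun x => ENNReal.ofReal (M / r) * ‖u x - c‖ₑ :=
    ((hu.continuous.sub continuous_const).enorm.measurable).const_mul _
  set I := (∫⁻ x in B, ‖fderiv ℝ u x‖ₑ ^ s) ^ (1 / s) with hI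
  calc (∫⁻ x in Metric.ball x₀ r, ‖u x - c‖ₑ ^ p) ^ (1 / p)
      ≤ (∫⁻ x, ‖v x‖ₑ ^ p) ^ (1 / p) := by
        gcongr ?_ ^ _
        rw [setLIntegral_congr_fun Metric.isOpen_ball.measurableSet
          (g := fun x => ‖v x‖ₑ ^ p) fun x hx => by simp only [hball x hx]]
        exact setLIntegral_le_lintegral _ _
    _ ≤ C * (∫⁻ x, ‖fderiv ℝ v x‖ₑ ^ s) ^ (1 / s) := hC v hvc hvs
    _ ≤ C * (∫⁻ x in B, (‖fderiv ℝ u x‖ₑ + ENNReal.ofReal (M / r) * ‖u x - c‖ₑ) ^ s) ^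
          (1 / s) := by
        refine mul_le_mul' le_rfl (ENNReal.rpow_le_rpow ?_ (by positivity))
        rw [← lintegral_indicator hB]
        refine lintegral_mono fun x => ?_
        refine (ENNReal.rpow_le_rpow (hvd x) hs0.le).trans (le_of_eq ?_)
        by_cases hx : x ∈ B
        · simp [hx]
        · simp [hx, hs0]
    _ ≤ C * (I + (∫⁻ x in B, (ENNReal.ofReal (M / r) * ‖u x - c‖ₑ) ^ s) ^ (1 / s)) := by
        gcongr
        exact ENNReal.lintegral_Lp_add_le hm1.aemeasurable hm2.aemeasurable hs.le
    _ = C * (I + ENNReal.ofReal (M / r) * (∫⁻ x in B, ‖u x - c‖ₑ ^ s) ^ (1 / s)) := by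
        simp_rw [ENNReal.mul_rpow_of_nonneg _ _ hs0.le]
        rw [lintegral_const_mul' _ _ (ENNReal.rpow_ne_top_of_nonneg hs0.le ENNReal.ofReal_ne_top),
          ENNReal.mul_rpow_of_nonneg _ _ (by positivity), ← ENNReal.rpow_mul,
          mul_one_div_cancel hs0.ne', ENNReal.rpow_one]
    _ ≤ C * (I + ENNReal.ofReal (M / r) * (ENNReal.ofReal (2 * (2 * r)) *
          ((2 ^ n) ^ (1 / s) * I))) := by gcongr
    _ = L * I := by
        have : ENNReal.ofReal (M / r) * ENNReal.ofReal (2 * (2 * r)) = ENNReal.ofReal (4 * M) := by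
          rw [← ENNReal.ofReal_mul (by positivity)]
          congr 1
          field_simp
          ring
        rw [← mul_assoc (ENNReal.ofReal (M / r)), this, hL]
        ring

/-! ### Mollification and passage to weak gradients. -/

open scoped Convolution

/-- The mollification of `f` by the normalised bump function `φ`. -/
def mollify {n : ℕ} (φ : ContDiffBump (0 : E n)) (f : E n → ℝ) : E n → ℝ :=
  φ.normed volume ⋆[ContinuousLinearMap.lsmul ℝ ℝ, volume] f

lemma contDiff_mollify {n : ℕ} (φ : ContDiffBump (0 : E n)) {f : E n → ℝ}
    (hf : LocallyIntegrable f) : ContDiff ℝ 1 (mollify φ f) :=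
  φ.hasCompactSupport_normed.contDiff_convolution_left _ φ.contDiff_normed hf

/-- The derivative of the convolution falls on the bump, and `t ↦ φ.normed volume (x - t)` is an
admissible test function whose derivative in `t` has the opposite sign. -/
lemma IsWeakGradient.fderiv_mollify {n : ℕ} {f : E n → ℝ} {g : E n → E n}
    (h : IsWeakGradient f g) (φ : ContDiffBump (0 : E n)) (x v : E n) :
    fderiv ℝ (mollify φ f) x v = ∫ t, inner ℝ (g t) v * φ.normed volume (x - t) := by
  set w := φ.normed (volume : Measure (E n)) with hw
  have hwc : ContDiff ℝ (⊤ : ℕ∞) w := φ.contDiff_normed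
  have hw1 : ContDiff ℝ 1 w := φ.contDiff_normed
  have hws : HasCompactSupport w := φ.hasCompactSupport_normed
  have e1 : mollify φ f = f ⋆[(ContinuousLinearMap.lsmul ℝ ℝ).flip, volume] w := by
    rw [convolution_flip]; rfl
  have h1 := (hws.hasFDerivAt_convolution_right (ContinuousLinearMap.lsmul ℝ ℝ).flip
    h.locallyIntegrable hw1 x).fderiv
  rw [e1, h1, convolution_precompR_apply _ h.locallyIntegrable (hws.fderiv ℝ)
    (hw1.continuous_fderiv one_ne_zero), convolution_def]
  have hψs : HasCompactSupport fun t => w (x - t) :=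
    hws.comp_homeomorph (Homeomorph.subLeft x)
  have hψd : ∀ t, fderiv ℝ (fun t => w (x - t)) t v = - fderiv ℝ w (x - t) v := by
    intro t
    have : HasFDerivAt (fun t => x - t) (-ContinuousLinearMap.id ℝ (E n)) t := by
      simpa using (hasFDerivAt_id t).const_sub x
    have := ((hw1.differentiable one_ne_zero _).hasFDerivAt).comp t this
    change HasFDerivAt (fun t => w (x - t)) _ t at this
    rw [this.fderiv]
    simp
  have key := h.integral_eq (fun t => w (x - t)) (hwc.comp (contDiff_const.sub contDiff_id)) hψs v
  simp only [hψd, mul_neg, integral_neg, neg_inj] at key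
  rw [← key]
  refine integral_congr_ae (ae_of_all _ fun t => ?_)
  simp [mul_comm]

lemma lintegral_normed {n : ℕ} (φ : ContDiffBump (0 : E n)) :
    ∫⁻ t, ENNReal.ofReal (φ.normed volume t) = 1 := by
  rw [← ofReal_integral_eq_lintegral_ofReal φ.integrable_normed
    (ae_of_all _ fun t => φ.nonneg_normed t), φ.integral_normed, ENNReal.ofReal_one]

lemma IsWeakGradient.enorm_fderiv_mollify_le {n : ℕ} {f : E n → ℝ} {g : E n → E n}
    (h : IsWeakGradient f g) (φ : ContDiffBump (0 : E n)) (x : E n) :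
    ‖fderiv ℝ (mollify φ f) x‖ₑ ≤
      ∫⁻ t, ENNReal.ofReal (φ.normed volume (x - t)) * ‖g t‖ₑ := by
  have hc : Continuous fun t => φ.normed (volume : Measure (E n)) (x - t) :=
    φ.continuous_normed.comp (by fun_prop)
  have hi : Integrable fun t => φ.normed volume (x - t) • g t :=
    h.locallyIntegrable_grad.integrable_smul_left_of_hasCompactSupport hc
      (φ.hasCompactSupport_normed.comp_homeomorph (Homeomorph.subLeft x))
  have e : ∀ t, ENNReal.ofReal (φ.normed volume (x - t)) * ‖g t‖ₑ =
      ENNReal.ofReal (φ.normed volume (x - t) * ‖g t‖) := fun t => by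
    rw [ENNReal.ofReal_mul (φ.nonneg_normed _), ofReal_norm]
  have hn : ∀ t, φ.normed volume (x - t) * ‖g t‖ = ‖φ.normed volume (x - t) • g t‖ := fun t => by
    rw [norm_smul, Real.norm_of_nonneg (φ.nonneg_normed _)]
  simp_rw [e, hn]
  rw [← ofReal_integral_eq_lintegral_ofReal hi.norm (ae_of_all _ fun t => norm_nonneg _),
    ← ofReal_norm]
  apply ENNReal.ofReal_le_ofReal
  refine ContinuousLinearMap.opNorm_le_bound _ (integral_nonneg fun t => norm_nonneg _) fun v => ?_
  rw [h.fderiv_mollify, ← integral_mul_const]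
  refine norm_integral_le_of_norm_le (hi.norm.mul_const _) (ae_of_all _ fun t => ?_)
  rw [norm_mul, norm_smul, mul_comm, mul_assoc]
  gcongr
  exact norm_inner_le_norm _ _

/-- Jensen for the probability density of the mollifier, then Tonelli. Mollifying at scale at most
`r` reads `g` only within the ball of radius `3 * r`. -/
lemma IsWeakGradient.setLIntegral_fderiv_mollify_le {n : ℕ} {f : E n → ℝ} {g : E n → E n}
    (h : IsWeakGradient f g) {s : ℝ} (hs : 1 < s) (x₀ : E n) {r : ℝ}
    (φ : ContDiffBump (0 : E n)) (hφ : φ.rOut ≤ r) :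
    ∫⁻ x in Metric.ball x₀ (2 * r), ‖fderiv ℝ (mollify φ f) x‖ₑ ^ s ≤
      ∫⁻ x in Metric.ball x₀ (3 * r), ‖g x‖ₑ ^ s := by
  have hgm : AEMeasurable (fun t => ‖g t‖ₑ) := h.locallyIntegrable_grad.aestronglyMeasurable.enorm
  set W : E n → ℝ≥0∞ := fun t => ENNReal.ofReal (φ.normed volume t) with hW
  have hWm : Measurable W := φ.continuous_normed.measurable.ennreal_ofReal
  set B2 := Metric.ball x₀ (2 * r)
  set B3 := Metric.ball x₀ (3 * r)
  have hB2 : MeasurableSet B2 := Metric.isOpen_ball.measurableSet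
  have hB3 : MeasurableSet B3 := Metric.isOpen_ball.measurableSet
  have h1 : ∀ x, ∫⁻ t, W (x - t) = 1 := fun x => by
    rw [lintegral_sub_left_eq_self W x, lintegral_normed]
  have h2 : ∀ t, ∫⁻ x, W (x - t) = 1 := fun t => by
    rw [lintegral_sub_right_eq_self W t, lintegral_normed]
  calc ∫⁻ x in B2, ‖fderiv ℝ (mollify φ f) x‖ₑ ^ s
      ≤ ∫⁻ x in B2, (∫⁻ t, W (x - t) * ‖g t‖ₑ) ^ s := by
        gcongr with x
        exact h.enorm_fderiv_mollify_le φ x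
    _ ≤ ∫⁻ x in B2, ∫⁻ t, W (x - t) * ‖g t‖ₑ ^ s := by
        gcongr with x
        exact lintegral_mul_rpow_le (hWm.comp (measurable_const_sub x)).aemeasurable hgm
          (h1 x).le hs
    _ ≤ ∫⁻ x in B2, ∫⁻ t in B3, W (x - t) * ‖g t‖ₑ ^ s := by
        refine setLIntegral_mono' hB2 fun x hx => ?_
        rw [← lintegral_indicator hB3]
        refine lintegral_mono fun t => ?_
        by_cases ht : t ∈ B3
        · rw [Set.indicator_of_mem ht]
        · have : W (x - t) = 0 := by
            have hns : x - t ∉ Function.support (φ.normed (volume : Measure (E n))) := by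
              rw [φ.support_normed_eq, mem_ball_zero_iff, ← dist_eq_norm]
              simp only [B2, B3, Metric.mem_ball] at hx ht
              have := dist_triangle_left t x₀ x
              linarith
            simp [hW, Function.notMem_support.1 hns]
          simp [this]
    _ ≤ ∫⁻ x, ∫⁻ t in B3, W (x - t) * ‖g t‖ₑ ^ s := setLIntegral_le_lintegral _ _
    _ = ∫⁻ t in B3, ‖g t‖ₑ ^ s := by
        rw [lintegral_lintegral_swap]
        · refine lintegral_congr_ae ?_
          filter_upwards with t
          have := lintegral_mul_const (μ := volume) (‖g t‖ₑ ^ s) (f := fun x => W (x - t))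
            (hWm.comp (measurable_sub_const t))
          rw [this, h2, one_mul]
        · exact ((hWm.comp measurable_sub).aemeasurable).mul
            ((hgm.restrict.pow_const s).comp_snd)

/-- The Sobolev–Poincaré inequality on balls for functions with a weak gradient. -/
theorem exists_sobolev_poincare {n : ℕ} (hn : n ≠ 0) {s p : ℝ} (hs : 1 < s)
    (hp : 1 ≤ p) (hsp : 1 / p = 1 / s - 1 / n) :
    ∃ C : ℝ≥0, ∀ (f : E n → ℝ) (g : E n → E n), IsWeakGradient f g →
      ∀ (x₀ : E n) (r : ℝ), 0 < r → ∃ c : ℝ,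
        (∫⁻ x in Metric.ball x₀ r, ‖f x - c‖ₑ ^ p) ^ (1 / p) ≤
          C * (∫⁻ x in Metric.ball x₀ (3 * r), ‖g x‖ₑ ^ s) ^ (1 / s) := by
  have hp0 : 0 < p := by linarith
  obtain ⟨C, hC⟩ := exists_sobolev_poincare_of_contDiff hn hs hp0 hsp
  refine ⟨2 * C, fun f g h x₀ r hr => ?_⟩
  set B := Metric.ball x₀ r
  have hB : MeasurableSet B := Metric.isOpen_ball.measurableSet
  have hpos : volume B ≠ 0 := (Metric.measure_ball_pos volume _ hr).ne'
  have hfin : volume B ≠ ⊤ := measure_ball_lt_top.ne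
  set X := C * (∫⁻ x in Metric.ball x₀ (3 * r), ‖g x‖ₑ ^ s) ^ (1 / s) with hX
  -- The outer and inner radii keep the fixed ratio `2`, which the almost everywhere convergence of
  -- the mollifications requires.
  let φ : ℕ → ContDiffBump (0 : E n) := fun m =>
    ⟨r / (m + 1) / 2, r / (m + 1), by positivity, half_lt_self (by positivity)⟩
  have hφr : ∀ m, (φ m).rOut ≤ r := fun m => div_le_self hr.le (by simp)
  have hφt : Tendsto (fun m => (φ m).rOut) atTop (𝓝 0) :=
    tendsto_const_div_atTop_nhds_zero_nat r |>.comp (tendsto_add_atTop_nat 1) |>.congr fun m => by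
      simp [φ]
  have hlim : ∀ᵐ x : E n, Tendsto (fun m => mollify (φ m) f x) atTop (𝓝 (f x)) :=
    ContDiffBump.ae_convolution_tendsto_right_of_locallyIntegrable (K := 2) hφt
      (Eventually.of_forall fun m => by simp only [φ]; linarith) h.locallyIntegrable
  have hu : ∀ m, ContDiff ℝ 1 (mollify (φ m) f) := fun m =>
    contDiff_mollify (φ m) h.locallyIntegrable
  -- The Sobolev–Poincaré constants vary with `m`. Double differences eliminate them, so that Fatou
  -- applies; a constant for `f` is recovered at the end as a value `f y`.
  set F : ℕ → E n × E n → ℝ≥0∞ := fun m q => ‖mollify (φ m) f q.2 - mollify (φ m) f q.1‖ₑ ^ p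
  have hFm : ∀ m, Measurable (F m) := fun m =>
    ((((hu m).continuous.comp continuous_snd).sub
      ((hu m).continuous.comp continuous_fst)).enorm.measurable).pow_const _
  set ν := (volume : Measure (E n)).restrict B
  have hstep : ∀ m, ∫⁻ q, F m q ∂(ν.prod ν) ≤ volume B * (2 * X) ^ p := by
    intro m
    obtain ⟨c, hc⟩ := hC _ (hu m) x₀ r hr
    have hc2 : (∫⁻ x in B, ‖mollify (φ m) f x - c‖ₑ ^ p) ≤ X ^ p := by
      rw [← ENNReal.rpow_inv_le_iff hp0, ← one_div]
      refine hc.trans ?_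
      rw [hX]
      gcongr _ * ?_ ^ _
      exact h.setLIntegral_fderiv_mollify_le hs x₀ (φ m) (hφr m)
    have hm : Measurable fun x => ‖mollify (φ m) f x - c‖ₑ ^ p :=
      (((hu m).continuous.sub continuous_const).enorm.measurable).pow_const _
    rw [lintegral_prod _ (hFm m).aemeasurable]
    calc ∫⁻ y, ∫⁻ x, F m (y, x) ∂ν ∂ν
        ≤ ∫⁻ y, ∫⁻ x, 2 ^ (p - 1) * (‖mollify (φ m) f x - c‖ₑ ^ p +
            ‖mollify (φ m) f y - c‖ₑ ^ p) ∂ν ∂ν := by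
          gcongr with y x
          refine le_trans ?_ (ENNReal.rpow_add_le_mul_rpow_add_rpow _ _ hp)
          refine ENNReal.rpow_le_rpow ?_ hp0.le
          have : mollify (φ m) f x - mollify (φ m) f y =
            (mollify (φ m) f x - c) - (mollify (φ m) f y - c) := by ring
          simp only
          rw [this]
          exact enorm_sub_le
      _ = 2 ^ (p - 1) * (volume B * (∫⁻ x, ‖mollify (φ m) f x - c‖ₑ ^ p ∂ν) +
            volume B * ∫⁻ x, ‖mollify (φ m) f x - c‖ₑ ^ p ∂ν) := by
          have h2 : (2 : ℝ≥0∞) ^ (p - 1) ≠ ⊤ :=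
            ENNReal.rpow_ne_top_of_nonneg (by linarith) (by simp)
          simp_rw [lintegral_const_mul' _ _ h2]
          congr 1
          simp_rw [lintegral_add_left hm, lintegral_const]
          rw [lintegral_add_left measurable_const, lintegral_const, lintegral_mul_const _ hm]
          simp only [ν, Measure.restrict_apply_univ]
          ring
      _ ≤ 2 ^ (p - 1) * (volume B * X ^ p + volume B * X ^ p) := by gcongr
      _ = volume B * (2 * X) ^ p := by
          clear_value X
          rw [ENNReal.mul_rpow_of_nonneg _ _ hp0.le, ENNReal.rpow_sub _ _ (by simp) (by simp),
            ENNReal.rpow_one, ← two_mul, ← mul_assoc,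
            ENNReal.div_mul_cancel (by simp) (by simp)]
          ring
  have hae : ∀ᵐ q ∂(ν.prod ν), Tendsto (fun m => F m q) atTop
      (𝓝 (‖f q.2 - f q.1‖ₑ ^ p)) := by
    have hν : ∀ᵐ x ∂ν, Tendsto (fun m => mollify (φ m) f x) atTop (𝓝 (f x)) :=
      ae_restrict_of_ae hlim
    filter_upwards [Measure.quasiMeasurePreserving_fst.ae hν,
      Measure.quasiMeasurePreserving_snd.ae hν] with q h1 h2
    exact (ENNReal.continuous_rpow_const.tendsto _).comp (h2.sub h1).enorm
  have hfatou : ∫⁻ q, ‖f q.2 - f q.1‖ₑ ^ p ∂(ν.prod ν) ≤ volume B * (2 * X) ^ p := by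
    calc ∫⁻ q, ‖f q.2 - f q.1‖ₑ ^ p ∂(ν.prod ν)
        = ∫⁻ q, liminf (fun m => F m q) atTop ∂(ν.prod ν) :=
          lintegral_congr_ae (hae.mono fun q hq => hq.liminf_eq.symm)
      _ ≤ liminf (fun m => ∫⁻ q, F m q ∂(ν.prod ν)) atTop := lintegral_liminf_le hFm
      _ ≤ volume B * (2 * X) ^ p := liminf_le_of_le (by isBoundedDefault) fun b hb => by
          obtain ⟨m, hm⟩ := hb.exists
          exact hm.trans (hstep m)
  have hfm : AEStronglyMeasurable f ν := h.locallyIntegrable.aestronglyMeasurable.restrict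
  have hpm : AEMeasurable (fun q : E n × E n => ‖f q.2 - f q.1‖ₑ ^ p) (ν.prod ν) :=
    ((hfm.comp_snd.sub hfm.comp_fst).enorm).pow_const _
  rw [lintegral_prod _ hpm] at hfatou
  obtain ⟨y, -, hy⟩ := exists_le_setLAverage hpos hfin
    (f := fun y => ∫⁻ x in B, ‖f x - f y‖ₑ ^ p) hpm.lintegral_prod_right'
  refine ⟨f y, ?_⟩
  rw [setLAverage_eq] at hy
  have h2 := hy.trans (ENNReal.div_le_of_le_mul' hfatou)
  rw [one_div, ENNReal.rpow_inv_le_iff hp0]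
  refine h2.trans (le_of_eq ?_)
  rw [hX]
  push_cast
  rw [mul_assoc]

/-! ### Polar coordinates and the cancellation of the rough kernel. -/

/-- The measure `r^{n-1} dr` on `(0, ∞)`. -/
abbrev radial (n : ℕ) : Measure (Set.Ioi (0 : ℝ)) :=
  Measure.volumeIoiPow (Module.finrank ℝ (E n) - 1)

instance instIsFiniteMeasureSurf (n : ℕ) : IsFiniteMeasure (surf n) :=
  inferInstanceAs (IsFiniteMeasure (volume : Measure (E n)).toSphere)

lemma homeomorph_fst_eq_direction {n : ℕ} (y : ({0}ᶜ : Set (E n))) :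
    (homeomorphUnitSphereProd (E n) y).1 = direction y.1 y.2 := by
  apply Subtype.ext
  rw [homeomorphUnitSphereProd_apply_fst_coe]
  rfl

lemma measurePreserving_polar (n : ℕ) : MeasurePreserving (homeomorphUnitSphereProd (E n))
    ((volume : Measure (E n)).comap (↑)) ((surf n).prod (radial n)) :=
  Measure.measurePreserving_homeomorphUnitSphereProd _

lemma nontrivial_euclidean {n : ℕ} (hn : n ≠ 0) : Nontrivial (E n) := by
  have : 0 < Module.finrank ℝ (E n) := by rw [finrank_euclideanSpace_fin]; omega
  exact Module.nontrivial_of_finrank_pos this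

/-- No integrability is assumed, since the product formula holds with the default value zero of the
Bochner integral. Hence the cancellation below holds for arbitrary radial factors. -/
lemma integral_polar {n : ℕ} (hn : n ≠ 0) {F : E n → ℝ} {P : Sph n → ℝ} {Q : ℝ → ℝ}
    (hF : ∀ y (hy : y ≠ 0), F y = P (direction y hy) * Q ‖y‖) :
    ∫ y, F y = (∫ θ, P θ ∂surf n) * ∫ r : Set.Ioi (0 : ℝ), Q r ∂radial n := by
  have := nontrivial_euclidean hn
  have h := (measurePreserving_polar n).integral_comp (Homeomorph.measurableEmbedding _)
    (fun q => P q.1 * Q q.2)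
  rw [integral_prod_mul (fun θ => P θ) (fun r : Set.Ioi (0 : ℝ) => Q r)] at h
  have e : ∫ y, F y = ∫ y : ({0}ᶜ : Set (E n)), F y ∂(volume : Measure (E n)).comap (↑) := by
    rw [integral_subtype_comap (measurableSet_singleton _).compl, restrict_compl_singleton]
  rw [← h, e]
  refine integral_congr_ae (ae_of_all _ fun y => ?_)
  simp only [homeomorph_fst_eq_direction, homeomorphUnitSphereProd_apply_snd_coe]
  exact hF y.1 y.2

lemma lintegral_polar {n : ℕ} (hn : n ≠ 0) {F : E n → ℝ≥0∞} {P : Sph n → ℝ≥0∞} {Q : ℝ → ℝ≥0∞}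
    (hP : AEMeasurable P (surf n)) (hQ : Measurable Q)
    (hF : ∀ y (hy : y ≠ 0), F y = P (direction y hy) * Q ‖y‖) :
    ∫⁻ y, F y = (∫⁻ θ, P θ ∂surf n) * ∫⁻ r : Set.Ioi (0 : ℝ), Q r ∂radial n := by
  have := nontrivial_euclidean hn
  have h := (measurePreserving_polar n).lintegral_comp_emb (Homeomorph.measurableEmbedding _)
    (fun q => P q.1 * Q q.2)
  rw [lintegral_prod_mul (g := fun r : Set.Ioi (0 : ℝ) => Q r) hP
    (hQ.comp measurable_subtype_coe).aemeasurable] at h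
  have e : ∫⁻ y, F y = ∫⁻ y : ({0}ᶜ : Set (E n)), F y ∂(volume : Measure (E n)).comap (↑) := by
    rw [lintegral_subtype_comap (measurableSet_singleton _).compl, restrict_compl_singleton]
  rw [← h, e]
  refine lintegral_congr fun y => ?_
  simp only [homeomorph_fst_eq_direction, homeomorphUnitSphereProd_apply_snd_coe]
  exact hF y.1 y.2

open Classical in
/-- The homogeneous extension `Ω(y/|y|)` of degree zero. -/
def angular {n : ℕ} (Ω : Sph n → ℝ) (y : E n) : ℝ :=
  if hy : y ≠ 0 then Ω (direction y hy) else 0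

lemma angular_of_ne {n : ℕ} (Ω : Sph n → ℝ) {y : E n} (hy : y ≠ 0) :
    angular Ω y = Ω (direction y hy) := dif_pos hy

lemma roughKernel_eq {n : ℕ} (Ω : Sph n → ℝ) (y : E n) :
    roughKernel Ω y = angular Ω y / ‖y‖ ^ n := by
  unfold roughKernel angular
  split_ifs <;> simp

lemma aestronglyMeasurable_angular {n : ℕ} (hn : n ≠ 0) {Ω : Sph n → ℝ}
    (hΩ : AEStronglyMeasurable Ω (surf n)) : AEStronglyMeasurable (angular Ω) volume := by
  have := nontrivial_euclidean hn
  have h1 : AEStronglyMeasurable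
      (fun y : ({0}ᶜ : Set (E n)) => Ω (homeomorphUnitSphereProd (E n) y).1)
      ((volume : Measure (E n)).comap (↑)) :=
    (hΩ.comp_fst (ν := radial n)).comp_measurePreserving (measurePreserving_polar n)
  have hemb : MeasurableEmbedding ((↑) : ({0}ᶜ : Set (E n)) → E n) :=
    MeasurableEmbedding.subtype_coe (measurableSet_singleton _).compl
  rw [← restrict_compl_singleton (μ := (volume : Measure (E n))) 0,
    ← map_comap_subtype_coe (measurableSet_singleton _).compl,
    hemb.aestronglyMeasurable_map_iff]
  refine h1.congr (ae_of_all _ fun y => ?_)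
  simp only [homeomorph_fst_eq_direction, Function.comp_apply]
  exact (angular_of_ne Ω y.2).symm

lemma aestronglyMeasurable_roughKernel {n : ℕ} (hn : n ≠ 0) {Ω : Sph n → ℝ}
    (hΩ : AEStronglyMeasurable Ω (surf n)) : AEStronglyMeasurable (roughKernel Ω) volume := by
  have h1 := aestronglyMeasurable_angular hn hΩ
  have h2 : Measurable fun y : E n => (‖y‖ ^ n)⁻¹ := (measurable_norm.pow_const n).inv
  refine (h1.mul h2.aestronglyMeasurable).congr (ae_of_all _ fun y => ?_)
  rw [roughKernel_eq]
  rfl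

lemma setLIntegral_angular_rpow {n : ℕ} (hn : n ≠ 0) {Ω : Sph n → ℝ}
    (hΩ : AEStronglyMeasurable Ω (surf n)) (q : ℝ) {R : ℝ} (hR : 0 < R) :
    ∫⁻ y in Metric.ball (0 : E n) R, ‖angular Ω y‖ₑ ^ q =
      (∫⁻ θ, ‖Ω θ‖ₑ ^ q ∂surf n) * ENNReal.ofReal (R ^ n / n) := by
  rw [← lintegral_indicator Metric.isOpen_ball.measurableSet]
  have hQm : Measurable ((Set.Iio R).indicator (1 : ℝ → ℝ≥0∞)) :=
    measurable_one.indicator measurableSet_Iio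
  rw [lintegral_polar hn (P := fun θ => ‖Ω θ‖ₑ ^ q) (hΩ.enorm.pow_const q) hQm]
  · congr 1
    have e : ∀ r : Set.Ioi (0 : ℝ), (Set.Iio R).indicator (1 : ℝ → ℝ≥0∞) r =
        (Set.Iio (⟨R, hR⟩ : Set.Ioi (0 : ℝ))).indicator 1 r := fun r => by
      simp only [Set.indicator_apply, Set.mem_Iio, ← Subtype.coe_lt_coe]
      rfl
    simp_rw [e]
    rw [lintegral_indicator_one measurableSet_Iio, Measure.volumeIoiPow_apply_Iio,
      finrank_euclideanSpace_fin]
    obtain ⟨m, rfl⟩ := Nat.exists_eq_succ_of_ne_zero hn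
    simp
  · intro y hy
    by_cases h : ‖y‖ < R
    · rw [Set.indicator_of_mem (mem_ball_zero_iff.2 h), Set.indicator_of_mem (Set.mem_Iio.2 h),
        angular_of_ne Ω hy, Pi.one_apply, mul_one]
    · rw [Set.indicator_of_notMem (fun h' => h (mem_ball_zero_iff.1 h')),
        Set.indicator_of_notMem (fun h' => h (Set.mem_Iio.1 h')), mul_zero]

lemma measurableSet_annulus (n : ℕ) (ε R : ℝ) : MeasurableSet (annulus n ε R) :=
  (measurableSet_lt measurable_const measurable_norm).inter
    (measurableSet_lt measurable_norm measurable_const)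

/-- The rough kernel has mean zero against radial functions. -/
lemma setIntegral_roughKernel_mul_radial {n : ℕ} (hn : n ≠ 0) {Ω : Sph n → ℝ}
    (h0 : ∫ θ, Ω θ ∂surf n = 0) (c : ℝ → ℝ) (ε R : ℝ) :
    ∫ y in annulus n ε R, roughKernel Ω y * c ‖y‖ = 0 := by
  rw [← integral_indicator (measurableSet_annulus n ε R), integral_polar hn (P := Ω)
    (Q := (Set.Ioo ε R).indicator fun r => c r / r ^ n), h0, zero_mul]
  intro y hy
  by_cases h : ε < ‖y‖ ∧ ‖y‖ < R
  · rw [Set.indicator_of_mem (show y ∈ annulus n ε R from h),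
      Set.indicator_of_mem (show ‖y‖ ∈ Set.Ioo ε R from h), roughKernel_eq, angular_of_ne Ω hy]
    ring
  · rw [Set.indicator_of_notMem (show y ∉ annulus n ε R from h),
      Set.indicator_of_notMem (show ‖y‖ ∉ Set.Ioo ε R from h), mul_zero]

lemma integrableOn_angular {n : ℕ} (hn : n ≠ 0) {Ω : Sph n → ℝ}
    (hΩ : Integrable Ω (surf n)) {R : ℝ} (hR : 0 < R) :
    IntegrableOn (angular Ω) (Metric.ball (0 : E n) R) := by
  refine ⟨(aestronglyMeasurable_angular hn hΩ.1).restrict, ?_⟩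
  have := setLIntegral_angular_rpow hn hΩ.1 1 hR
  simp only [ENNReal.rpow_one] at this
  rw [hasFiniteIntegral_iff_enorm, this]
  exact ENNReal.mul_lt_top hΩ.2 ENNReal.ofReal_lt_top

/-! ### Estimates on dyadic shells. -/

/-- The integer `k` with `2^k ≤ r < 2^{k+1}`, for `r > 0`. -/
def dyadicIndex (r : ℝ) : ℤ := ⌊Real.logb 2 r⌋

lemma measurable_dyadicIndex : Measurable dyadicIndex :=
  Int.measurable_floor.comp (Real.measurable_log.div_const _)

lemma dyadicIndex_eq_iff {r : ℝ} (hr : 0 < r) (k : ℤ) :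
    dyadicIndex r = k ↔ (2 : ℝ) ^ k ≤ r ∧ r < 2 ^ (k + 1) := by
  rw [dyadicIndex, Int.floor_eq_iff, Real.le_logb_iff_rpow_le one_lt_two hr,
    Real.logb_lt_iff_lt_rpow one_lt_two hr, Real.rpow_intCast, ← Real.rpow_intCast 2 (k + 1)]
  push_cast
  rfl

/-- The dyadic shell `2^k ≤ |y| < 2^{k+1}`. -/
def shell (n : ℕ) (k : ℤ) : Set (E n) := {y | (2 : ℝ) ^ k ≤ ‖y‖ ∧ ‖y‖ < 2 ^ (k + 1)}

lemma measurableSet_shell (n : ℕ) (k : ℤ) : MeasurableSet (shell n k) :=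
  (measurableSet_le measurable_const measurable_norm).inter
    (measurableSet_lt measurable_norm measurable_const)

lemma lintegral_le_tsum_shell {n : ℕ} (hn : n ≠ 0) (H : E n → ℝ≥0∞) :
    ∫⁻ y, H y ≤ ∑' k : ℤ, ∫⁻ y in shell n k, H y := by
  have := nontrivial_euclidean hn
  calc ∫⁻ y, H y = ∫⁻ y in {0}ᶜ, H y := by rw [restrict_compl_singleton]
    _ ≤ ∫⁻ y in ⋃ k, shell n k, H y := by
        refine lintegral_mono_set fun y hy => Set.mem_iUnion.2 ⟨dyadicIndex ‖y‖, ?_⟩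
        exact (dyadicIndex_eq_iff (norm_pos_iff.2 hy) _).1 rfl
    _ ≤ _ := lintegral_iUnion_le _ _

/-- On the shell `|y|^(-n) ≤ 2^(-kn)`; what remains is Hölder on the surrounding ball. -/
lemma setLIntegral_shell_roughKernel_le {n : ℕ} (hn : n ≠ 0) {Ω : Sph n → ℝ}
    (hΩ : AEStronglyMeasurable Ω (surf n)) {ρ q : ℝ} (hρ : ρ.HolderConjugate q)
    {F : E n → ℝ≥0∞} (hF : AEMeasurable F) (k : ℤ) :
    ∫⁻ y in shell n k, ‖roughKernel Ω y‖ₑ * F y ≤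
      (ENNReal.ofReal (2 ^ k) ^ n)⁻¹ *
        (((∫⁻ θ, ‖Ω θ‖ₑ ^ ρ ∂surf n) * ENNReal.ofReal ((2 ^ (k + 1)) ^ n / n)) ^ (1 / ρ) *
          (∫⁻ y in Metric.ball (0 : E n) (2 ^ (k + 1)), F y ^ q) ^ (1 / q)) := by
  have h2k : (0 : ℝ) < 2 ^ k := by positivity
  have hτ : (ENNReal.ofReal (2 ^ k) ^ n)⁻¹ ≠ ⊤ := by
    simp [h2k]
  have ham := (aestronglyMeasurable_angular hn hΩ).enorm
  calc ∫⁻ y in shell n k, ‖roughKernel Ω y‖ₑ * F y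
      ≤ ∫⁻ y in shell n k, (ENNReal.ofReal (2 ^ k) ^ n)⁻¹ * (‖angular Ω y‖ₑ * F y) := by
        refine setLIntegral_mono' (measurableSet_shell n k) fun y hy => ?_
        rw [← mul_assoc]
        gcongr
        have hy0 : 0 < ‖y‖ := h2k.trans_le hy.1
        rw [roughKernel_eq, div_eq_mul_inv, enorm_mul, mul_comm]
        gcongr
        rw [← ofReal_norm, norm_inv, norm_pow, norm_norm,
          ENNReal.ofReal_inv_of_pos (by positivity), ENNReal.ofReal_pow hy0.le]
        gcongr
        exact hy.1
    _ = (ENNReal.ofReal (2 ^ k) ^ n)⁻¹ * ∫⁻ y in shell n k, ‖angular Ω y‖ₑ * F y :=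
        lintegral_const_mul' _ _ hτ
    _ ≤ (ENNReal.ofReal (2 ^ k) ^ n)⁻¹ *
          ∫⁻ y in Metric.ball (0 : E n) (2 ^ (k + 1)), ‖angular Ω y‖ₑ * F y := by
        gcongr
        intro y hy
        exact mem_ball_zero_iff.2 hy.2
    _ ≤ _ := by
        gcongr
        rw [← setLIntegral_angular_rpow hn hΩ ρ (by positivity)]
        exact ENNReal.lintegral_mul_le_Lp_mul_Lq _ hρ ham.restrict hF.restrict

lemma setLIntegral_ball_sub_left {n : ℕ} (H : E n → ℝ≥0∞) (x : E n) (R : ℝ) :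
    ∫⁻ y in Metric.ball (0 : E n) R, H (x - y) = ∫⁻ y in Metric.ball x R, H y := by
  rw [← lintegral_indicator Metric.isOpen_ball.measurableSet,
    ← lintegral_indicator Metric.isOpen_ball.measurableSet,
    ← lintegral_sub_left_eq_self ((Metric.ball x R).indicator H) x]
  refine lintegral_congr fun y => ?_
  have : y ∈ Metric.ball (0 : E n) R ↔ x - y ∈ Metric.ball x R := by
    simp [dist_eq_norm]
  by_cases h : y ∈ Metric.ball (0 : E n) R
  · rw [Set.indicator_of_mem h, Set.indicator_of_mem (this.1 h)]
  · rw [Set.indicator_of_notMem h, Set.indicator_of_notMem (fun h' => h (this.2 h'))]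

/-- The mean of `h` over the closed ball of radius `r` about `x`. -/
def ballMean {n : ℕ} (h : E n → ℝ≥0∞) (x : E n) (r : ℝ) : ℝ≥0∞ :=
  (∫⁻ y in Metric.closedBall x r, h y) / volume (Metric.closedBall x r)

lemma ballMean_le_maximal {n : ℕ} (h : E n → ℝ≥0∞) (x : E n) {r : ℝ} (hr : 0 < r) :
    ballMean h x r ≤ maximal h x :=
  le_iSup₂ (f := fun (r : ℝ) (_ : 0 < r) => ballMean h x r) r hr

lemma setLIntegral_rpow_le_ballMean {n : ℕ} {g : E n → E n} (hg : AEStronglyMeasurable g)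
    {s α : ℝ} (hs : 0 < s) (hsα : s ≤ α) (x : E n) {r : ℝ} (hr : 0 < r) :
    (∫⁻ y in Metric.ball x r, ‖g y‖ₑ ^ s) ^ (1 / s) ≤
      volume (Metric.closedBall x r) ^ (1 / s) * ballMean (fun y => ‖g y‖ₑ ^ α) x r ^ (1 / α) := by
  have hα : 0 < α := hs.trans_le hsα
  have hpos := (Metric.measure_closedBall_pos volume x hr).ne'
  have hfin : volume (Metric.closedBall x r) ≠ ⊤ := measure_closedBall_lt_top.ne
  have key := eLpNorm'_le_eLpNorm'_mul_rpow_measure_univ hs hsα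
    (hg.restrict (s := Metric.closedBall x r))
  rw [eLpNorm', eLpNorm', Measure.restrict_apply_univ] at key
  calc _ ≤ (∫⁻ y in Metric.closedBall x r, ‖g y‖ₑ ^ s) ^ (1 / s) := by
        gcongr ?_ ^ _
        exact lintegral_mono_set Metric.ball_subset_closedBall
    _ ≤ _ := key
    _ = _ := by
        rw [ballMean, ENNReal.div_rpow_of_nonneg _ _ (by positivity), ENNReal.rpow_sub _ _ hpos hfin]
        simp only [div_eq_mul_inv]
        ring

/-- The scaling identity behind the choice of `s`: all powers of the radius combine to exactly one.
-/
lemma inv_pow_mul_rpow_mul_rpow {n : ℕ} (hn : n ≠ 0) {ρ s : ℝ} (h : 1 / ρ + 1 / s = 1 + 1 / n)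
    {τ : ℝ≥0∞} (h0 : τ ≠ 0) (ht : τ ≠ ⊤) :
    (τ ^ n)⁻¹ * ((τ ^ n) ^ (1 / ρ) * (τ ^ n) ^ (1 / s)) = τ := by
  have hn' : (n : ℝ) ≠ 0 := by exact_mod_cast hn
  have h0n : τ ^ n ≠ 0 := pow_ne_zero _ h0
  have htn : τ ^ n ≠ ⊤ := ENNReal.pow_ne_top ht
  rw [← ENNReal.rpow_add _ _ h0n htn, h, ENNReal.rpow_add _ _ h0n htn, ENNReal.rpow_one,
    ← mul_assoc, ENNReal.inv_mul_cancel h0n htn, one_mul, ← ENNReal.rpow_natCast,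
    ← ENNReal.rpow_mul, mul_one_div_cancel hn', ENNReal.rpow_one]

/-- The estimate of the singular integral over a dyadic shell. -/
theorem exists_setLIntegral_shell_le {n : ℕ} (hn : n ≠ 0) {ρ s α : ℝ} (hρ : 1 < ρ) (hs : 1 < s)
    (hρs : 1 / ρ + 1 / s = 1 + 1 / n) (hsα : s ≤ α) :
    ∃ C : ℝ≥0, ∀ (Ω : Sph n → ℝ) (f : E n → ℝ) (g : E n → E n),
      AEStronglyMeasurable Ω (surf n) → IsWeakGradient f g → ∀ x : E n, ∃ c : ℤ → ℝ, ∀ k : ℤ,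
        ∫⁻ y in shell n k, ‖roughKernel Ω y‖ₑ * ‖f (x - y) - c k‖ₑ ≤
          C * (∫⁻ θ, ‖Ω θ‖ₑ ^ ρ ∂surf n) ^ (1 / ρ) * (ENNReal.ofReal (2 ^ k) *
            ballMean (fun y => ‖g y‖ₑ ^ α) x (6 * 2 ^ k) ^ (1 / α)) := by
  have hρ0 : 0 < ρ := by linarith
  have hs0 : 0 < s := by linarith
  have hpq := Real.HolderConjugate.conjExponent hρ
  set q := ρ.conjExponent
  have hq : 1 / q = 1 / s - 1 / n := by
    have := hpq.one_div_add_one_div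
    simp only [div_one] at this
    linarith
  obtain ⟨C, hC⟩ := exists_sobolev_poincare hn hs hpq.symm.lt.le hq
  set ω := volume (Metric.ball (0 : E n) 1)
  set c1 : ℝ≥0∞ := ENNReal.ofReal (2 ^ n / n)
  set c2 : ℝ≥0∞ := ENNReal.ofReal (6 ^ n) * ω
  set D : ℝ≥0∞ := C * c1 ^ (1 / ρ) * c2 ^ (1 / s) with hD
  have hDt : D ≠ ⊤ := by
    refine ENNReal.mul_ne_top (ENNReal.mul_ne_top ENNReal.coe_ne_top ?_) ?_
    · exact ENNReal.rpow_ne_top_of_nonneg (by positivity) ENNReal.ofReal_ne_top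
    · exact ENNReal.rpow_ne_top_of_nonneg (by positivity)
        (ENNReal.mul_ne_top ENNReal.ofReal_ne_top measure_ball_lt_top.ne)
  refine ⟨D.toNNReal, fun Ω f g hΩ h x => ?_⟩
  rw [ENNReal.coe_toNNReal hDt]
  -- The ball of radius `2^(k+1)` contains the shell; Sobolev–Poincaré triples it, whence the radius
  -- `6 * 2^k`.
  choose c hc using fun k : ℤ => hC f g h x (2 ^ (k + 1)) (by positivity)
  refine ⟨c, fun k => ?_⟩
  have h2k : (0 : ℝ) < 2 ^ k := by positivity
  have h2k1 : (2 : ℝ) ^ (k + 1) = 2 * 2 ^ k := by rw [zpow_add_one₀ two_ne_zero, mul_comm]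
  set τ := ENNReal.ofReal (2 ^ k)
  have hτ0 : τ ≠ 0 := by simp [τ, h2k]
  have hτt : τ ≠ ⊤ := ENNReal.ofReal_ne_top
  set a := ballMean (fun y => ‖g y‖ₑ ^ α) x (6 * 2 ^ k) ^ (1 / α)
  set N := ∫⁻ θ, ‖Ω θ‖ₑ ^ ρ ∂surf n
  have hfm : AEMeasurable (fun y => ‖f (x - y) - c k‖ₑ) :=
    ((h.locallyIntegrable.aestronglyMeasurable.comp_quasiMeasurePreserving
      (quasiMeasurePreserving_sub_left volume x)).sub aestronglyMeasurable_const).enorm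
  have hF : (∫⁻ y in Metric.ball (0 : E n) (2 ^ (k + 1)), ‖f (x - y) - c k‖ₑ ^ q) ^ (1 / q) ≤
      C * ((c2 * τ ^ n) ^ (1 / s) * a) := by
    rw [setLIntegral_ball_sub_left (fun z => ‖f z - c k‖ₑ ^ q)]
    refine (hc k).trans ?_
    have e : 3 * (2 : ℝ) ^ (k + 1) = 6 * 2 ^ k := by rw [h2k1]; ring
    rw [e]
    gcongr
    refine (setLIntegral_rpow_le_ballMean h.locallyIntegrable_grad.aestronglyMeasurable hs0 hsα x
      (by positivity)).trans (le_of_eq ?_)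
    rw [volume_closedBall_eq x (by positivity), mul_pow, ENNReal.ofReal_mul (by positivity),
      ENNReal.ofReal_pow h2k.le]
    congr 2
    ring
  have hN : ENNReal.ofReal ((2 ^ (k + 1)) ^ n / n) = c1 * τ ^ n := by
    rw [← ENNReal.ofReal_pow h2k.le, ← ENNReal.ofReal_mul (by positivity), h2k1, mul_pow]
    congr 1
    ring
  refine (setLIntegral_shell_roughKernel_le hn hΩ hpq hfm k).trans ?_
  rw [hN]
  calc _ ≤ (τ ^ n)⁻¹ * ((N * (c1 * τ ^ n)) ^ (1 / ρ) * (C * ((c2 * τ ^ n) ^ (1 / s) * a))) := by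
        gcongr
    _ = D * N ^ (1 / ρ) * (((τ ^ n)⁻¹ * ((τ ^ n) ^ (1 / ρ) * (τ ^ n) ^ (1 / s))) * a) := by
        rw [ENNReal.mul_rpow_of_nonneg _ _ (by positivity : 0 ≤ 1 / ρ),
          ENNReal.mul_rpow_of_nonneg c1 _ (by positivity : 0 ≤ 1 / ρ),
          ENNReal.mul_rpow_of_nonneg _ _ (by positivity : 0 ≤ 1 / s), hD]
        ring
    _ = _ := by rw [inv_pow_mul_rpow_mul_rpow hn hρs hτ0 hτt]

/-! ### Hedberg summation, Morrey bounds and the pointwise estimate. -/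

/-- Hedberg's summation argument. -/
lemma tsum_hedberg_le {θ : ℝ} (hθ : 1 < θ) (a : ℤ → ℝ≥0∞) (m M : ℝ≥0∞)
    (h1 : ∀ k, a k ≤ m) (h2 : ∀ k : ℤ, a k ≤ M * ENNReal.ofReal (2 ^ (-θ * k))) :
    ∑' k : ℤ, ENNReal.ofReal (2 ^ k) * a k ≤
      ENNReal.ofReal (2 ^ (θ - 1) * twoSidedSum (θ - 1)) * (M ^ (1 / θ) * m ^ (1 - 1 / θ)) := by
  have hθ0 : 0 < θ := by linarith
  have hγ : 0 < θ - 1 := by linarith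
  have hT := twoSidedSum_pos hγ
  have hθ' : 0 < 1 - 1 / θ := by
    rw [sub_pos, div_lt_one hθ0]; exact hθ
  have hc0 : ENNReal.ofReal (2 ^ (θ - 1) * twoSidedSum (θ - 1)) ≠ 0 := by
    simp only [ne_eq, ENNReal.ofReal_eq_zero, not_le]; positivity
  by_cases hm0 : m = 0
  · have : ∀ k, a k = 0 := fun k => le_antisymm ((h1 k).trans hm0.le) zero_le
    simp [this]
  by_cases hM0 : M = 0
  · have : ∀ k, a k = 0 := fun k => le_antisymm ((h2 k).trans (by simp [hM0])) zero_le
    simp [this]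
  by_cases hmt : m = ⊤
  · rw [hmt, ENNReal.top_rpow_of_pos hθ', ENNReal.mul_top, ENNReal.mul_top hc0]
    · exact le_top
    · simp [hM0, ENNReal.rpow_eq_zero_iff]
      intro _
      exact hθ0.le
  by_cases hMt : M = ⊤
  · rw [hMt, ENNReal.top_rpow_of_pos (by positivity), ENNReal.top_mul, ENNReal.mul_top hc0]
    · exact le_top
    · simp only [ne_eq, ENNReal.rpow_eq_zero_iff, hm0, hmt, false_and, or_self, not_false_eq_true]
  obtain ⟨m, rfl⟩ : ∃ r : ℝ≥0, m = r := ⟨m.toNNReal, (ENNReal.coe_toNNReal hmt).symm⟩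
  obtain ⟨M, rfl⟩ : ∃ r : ℝ≥0, M = r := ⟨M.toNNReal, (ENNReal.coe_toNNReal hMt).symm⟩
  have hm : (0 : ℝ) < m := by
    simp only [ENNReal.coe_eq_zero] at hm0
    exact_mod_cast pos_iff_ne_zero.2 hm0
  have hM : (0 : ℝ) < M := by
    simp only [ENNReal.coe_eq_zero] at hM0
    exact_mod_cast pos_iff_ne_zero.2 hM0
  -- At `2^k = τ` the bounds `m` and `M * 2^(-θk)` coincide. Rounding `τ` down to `2^k₀` costs the
  -- factor `2^(θ-1)`.
  set τ : ℝ := ((M : ℝ) / m) ^ (1 / θ) with hτ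
  have hτ0 : 0 < τ := by positivity
  have hτθ : τ ^ θ = M / m := by
    rw [hτ, ← Real.rpow_mul (by positivity), one_div_mul_cancel hθ0.ne', Real.rpow_one]
  have hMτ : (M : ℝ) * τ ^ (-(θ - 1)) = τ * m := by
    have : τ ^ (-(θ - 1)) = τ / τ ^ θ := by
      rw [show -(θ - 1) = 1 - θ by ring, Real.rpow_sub hτ0, Real.rpow_one]
    rw [this, hτθ]
    field_simp
  have hτm : τ * m = (M : ℝ) ^ (1 / θ) * (m : ℝ) ^ (1 - 1 / θ) := by
    rw [hτ, Real.div_rpow hM.le hm.le, Real.rpow_sub hm, Real.rpow_one]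
    field_simp
  obtain ⟨k₀, hk1, hk2⟩ := exists_mem_Ico_zpow hτ0 (one_lt_two (α := ℝ))
  have hk0 : (2 : ℝ) ^ (-(θ - 1) * k₀) ≤ 2 ^ (θ - 1) * τ ^ (-(θ - 1)) := by
    have e : (2 : ℝ) ^ (-(θ - 1) * k₀) = ((2 : ℝ) ^ k₀) ^ (-(θ - 1)) := by
      rw [mul_comm, Real.rpow_mul (by norm_num), Real.rpow_intCast]
    have hle : τ / 2 ≤ (2 : ℝ) ^ k₀ := by
      rw [zpow_add_one₀ two_ne_zero] at hk2
      linarith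
    rw [e]
    calc ((2 : ℝ) ^ k₀) ^ (-(θ - 1)) ≤ (τ / 2) ^ (-(θ - 1)) :=
          Real.rpow_le_rpow_of_nonpos (by positivity) hle (by linarith)
      _ = _ := by
          rw [Real.div_rpow hτ0.le (by norm_num), Real.rpow_neg (by norm_num : (0 : ℝ) ≤ 2),
            div_inv_eq_mul, mul_comm]
  have hγ2 : (1 : ℝ) ≤ 2 ^ (θ - 1) := Real.one_le_rpow (by norm_num) hγ.le
  have key := tsum_le_of_le_min hγ (ENNReal.ofReal (2 ^ (θ - 1) * (τ * m)))
    (fun k => ENNReal.ofReal (2 ^ k) * a k) k₀ ?_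
  · refine key.trans (le_of_eq ?_)
    rw [← ENNReal.ofReal_coe_nnreal (p := m), ← ENNReal.ofReal_coe_nnreal (p := M),
      ENNReal.ofReal_rpow_of_pos hM, ENNReal.ofReal_rpow_of_pos hm,
      ← ENNReal.ofReal_mul (by positivity), ← ENNReal.ofReal_mul (by positivity),
      ← ENNReal.ofReal_mul (by positivity), hτm]
    congr 1
    ring
  · intro j
    rw [← ENNReal.ofReal_mul (by positivity), mul_min_of_nonneg _ _ (by positivity),
      ENNReal.ofReal_min]
    have ej : (2 : ℝ) ^ (j + k₀) = 2 ^ (j : ℝ) * 2 ^ k₀ := by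
      rw [zpow_add₀ two_ne_zero, Real.rpow_intCast]
    refine le_min ?_ ?_
    · refine (mul_le_mul' le_rfl (h1 _)).trans ?_
      rw [← ENNReal.ofReal_coe_nnreal (p := m), ← ENNReal.ofReal_mul (by positivity)]
      apply ENNReal.ofReal_le_ofReal
      calc (2 : ℝ) ^ (j + k₀) * m = 1 * (2 ^ k₀ * m) * 2 ^ (j : ℝ) := by rw [ej]; ring
        _ ≤ 2 ^ (θ - 1) * (τ * m) * 2 ^ (j : ℝ) := by gcongr
    · refine (mul_le_mul' le_rfl (h2 _)).trans ?_
      rw [← ENNReal.ofReal_coe_nnreal (p := M), ← ENNReal.ofReal_mul (by positivity),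
        ← ENNReal.ofReal_mul (by positivity)]
      apply ENNReal.ofReal_le_ofReal
      have e : (2 : ℝ) ^ (j + k₀) * (M * 2 ^ (-θ * ((j + k₀ : ℤ) : ℝ))) =
          M * 2 ^ (-(θ - 1) * k₀) * 2 ^ (-(θ - 1) * j) := by
        have : (2 : ℝ) ^ (j + k₀) = 2 ^ ((j + k₀ : ℤ) : ℝ) := (Real.rpow_intCast _ _).symm
        rw [this, mul_left_comm, ← Real.rpow_add two_pos, mul_assoc, ← Real.rpow_add two_pos]
        push_cast
        ring_nf
      rw [e]
      calc (M : ℝ) * 2 ^ (-(θ - 1) * k₀) * 2 ^ (-(θ - 1) * j)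
          ≤ M * (2 ^ (θ - 1) * τ ^ (-(θ - 1))) * 2 ^ (-(θ - 1) * j) := by gcongr
        _ = 2 ^ (θ - 1) * (M * τ ^ (-(θ - 1))) * 2 ^ (-(θ - 1) * j) := by ring
        _ = _ := by rw [hMτ]

lemma setLIntegral_ball_le_morreyNorm {n : ℕ} (hn : n ≠ 0) {α : ℝ} (hα : 0 < α) (β : ℝ)
    (g : E n → E n) (x : E n) {r : ℝ} (hr : 0 < r) :
    ∫⁻ y in Metric.ball x r, ‖g y‖ₑ ^ α ≤
      morreyNorm α (α * n / β) g ^ α * ENNReal.ofReal (r ^ (n - β)) := by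
  have hn' : (n : ℝ) ≠ 0 := by exact_mod_cast hn
  have e : (n : ℝ) * (1 - α / (α * n / β)) = n - β := by
    rw [div_div_eq_mul_div, mul_div_mul_left _ _ hα.ne', mul_sub, mul_one, mul_div_cancel₀ _ hn']
  have h1 : ((∫⁻ y in Metric.ball x r, ‖g y‖ₑ ^ α) / ENNReal.ofReal (r ^ (n - β))) ^ (1 / α) ≤
      morreyNorm α (α * n / β) g := by
    unfold morreyNorm
    rw [e]
    exact le_iSup₂_of_le x r (le_iSup_of_le hr le_rfl)
  have hpos : 0 < r ^ ((n : ℝ) - β) := by positivity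
  rw [one_div, ENNReal.rpow_inv_le_iff hα, ENNReal.div_le_iff_le_mul
    (Or.inl (by simpa using hpos)) (Or.inl ENNReal.ofReal_ne_top)] at h1
  exact h1

/-- The constant in the Morrey bound for means over balls. -/
def morreyConst (n : ℕ) (β : ℝ) : ℝ≥0∞ :=
  ENNReal.ofReal (2 ^ ((n : ℝ) - β)) / volume (Metric.ball (0 : E n) 1)

lemma morreyConst_ne_top (n : ℕ) (β : ℝ) : morreyConst n β ≠ ⊤ :=
  ENNReal.div_ne_top ENNReal.ofReal_ne_top (Metric.measure_ball_pos volume _ one_pos).ne'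

/-- A closed ball sits in the open ball of twice the radius, which accounts for `2^(n-β)` in the
constant; dividing by the volume leaves `r^(-β)`. -/
lemma ballMean_le_morreyNorm {n : ℕ} (hn : n ≠ 0) {α : ℝ} (hα : 0 < α) (β : ℝ)
    (g : E n → E n) (x : E n) {r : ℝ} (hr : 0 < r) :
    ballMean (fun y => ‖g y‖ₑ ^ α) x r ≤
      morreyConst n β * morreyNorm α (α * n / β) g ^ α * ENNReal.ofReal (r ^ (-β)) := by
  have hω0 : volume (Metric.ball (0 : E n) 1) ≠ 0 :=
    (Metric.measure_ball_pos volume _ one_pos).ne'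
  have hωt : volume (Metric.ball (0 : E n) 1) ≠ ⊤ := measure_ball_lt_top.ne
  have h1 : ∫⁻ y in Metric.closedBall x r, ‖g y‖ₑ ^ α ≤
      morreyNorm α (α * n / β) g ^ α * ENNReal.ofReal ((2 * r) ^ (n - β)) :=
    (lintegral_mono_set (Metric.closedBall_subset_ball (by linarith))).trans
      (setLIntegral_ball_le_morreyNorm hn hα β g x (show 0 < 2 * r by positivity))
  have h2 : ENNReal.ofReal ((2 * r) ^ ((n : ℝ) - β)) =
      ENNReal.ofReal (2 ^ ((n : ℝ) - β)) * ENNReal.ofReal (r ^ (-β)) * ENNReal.ofReal (r ^ n) := by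
    rw [← ENNReal.ofReal_mul (by positivity), ← ENNReal.ofReal_mul (by positivity),
      Real.mul_rpow (by norm_num) hr.le, mul_assoc, ← Real.rpow_natCast r n,
      ← Real.rpow_add hr]
    ring_nf
  have hrn : ENNReal.ofReal (r ^ n) ≠ 0 := by simp [hr]
  rw [ballMean, volume_closedBall_eq x hr.le, ENNReal.div_le_iff_le_mul
    (Or.inl (mul_ne_zero hrn hω0)) (Or.inl (ENNReal.mul_ne_top ENNReal.ofReal_ne_top hωt))]
  refine h1.trans (le_of_eq ?_)
  rw [h2, morreyConst]
  calc _ = (ENNReal.ofReal (2 ^ ((n : ℝ) - β)) / volume (Metric.ball (0 : E n) 1) *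
        volume (Metric.ball (0 : E n) 1)) * morreyNorm α (α * n / β) g ^ α *
        ENNReal.ofReal (r ^ (-β)) * ENNReal.ofReal (r ^ n) := by
        rw [ENNReal.div_mul_cancel hω0 hωt]; ring
    _ = _ := by ring

/-- `|g|^α` need not be globally integrable, so the weak type bound does not give finiteness. Small
radii are handled by Besicovitch differentiation of the locally finite measure with density `|g|^α`,
large ones by the Morrey bound. -/
lemma ae_maximal_lt_top {n : ℕ} (hn : n ≠ 0) {α β : ℝ} (hα : 0 < α) (hβ : 0 < β)
    {g : E n → E n} (hM : morreyNorm α (α * n / β) g < ⊤) :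
    ∀ᵐ x, maximal (fun y => ‖g y‖ₑ ^ α) x < ⊤ := by
  have hMα : morreyNorm α (α * n / β) g ^ α ≠ ⊤ := ENNReal.rpow_ne_top_of_nonneg hα.le hM.ne
  set ν := (volume : Measure (E n)).withDensity fun y => ‖g y‖ₑ ^ α with hν
  have hfin : IsLocallyFiniteMeasure ν := by
    refine ⟨fun x => ⟨Metric.ball x 1, Metric.ball_mem_nhds x one_pos, ?_⟩⟩
    rw [hν, withDensity_apply _ Metric.isOpen_ball.measurableSet]
    exact (setLIntegral_ball_le_morreyNorm hn hα β g x one_pos).trans_lt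
      (ENNReal.mul_lt_top hMα.lt_top ENNReal.ofReal_lt_top)
  filter_upwards [Besicovitch.ae_tendsto_rnDeriv ν (volume : Measure (E n)),
    Measure.rnDeriv_lt_top ν (volume : Measure (E n))] with x hx hlt
  obtain ⟨b, hb1, hb2⟩ := exists_between hlt
  have hev := hx.eventually_lt_const hb1
  rw [eventually_nhdsWithin_iff, Metric.eventually_nhds_iff] at hev
  obtain ⟨δ, hδ, hball⟩ := hev
  set b' := morreyConst n β * morreyNorm α (α * n / β) g ^ α * ENNReal.ofReal (δ ^ (-β))
  have hb' : b' < ⊤ := by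
    refine ENNReal.mul_lt_top (ENNReal.mul_lt_top (morreyConst_ne_top n β).lt_top hMα.lt_top)
      ENNReal.ofReal_lt_top
  refine lt_of_le_of_lt (iSup₂_le fun r hr => ?_) (max_lt hb2 hb')
  rcases lt_or_ge r δ with h | h
  · refine le_max_of_le_left ?_
    have := hball (y := r) (by rwa [Real.dist_eq, sub_zero, abs_of_pos hr]) hr
    rw [hν, withDensity_apply _ Metric.isClosed_closedBall.measurableSet] at this
    exact this.le
  · refine le_max_of_le_right ((ballMean_le_morreyNorm hn hα β g x hr).trans ?_)
    exact mul_le_mul' le_rfl (ENNReal.ofReal_le_ofReal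
      (Real.rpow_le_rpow_of_nonpos hδ h (by linarith)))

/-- The pointwise bound for the regularised singular integral. -/
theorem exists_lintegral_roughKernel_mul_le {n : ℕ} (hn : n ≠ 0) {ρ s α β : ℝ} (hρ : 1 < ρ)
    (hs : 1 < s) (hρs : 1 / ρ + 1 / s = 1 + 1 / n) (hsα : s ≤ α) (hαβ : α < β) :
    ∃ C : ℝ≥0, ∀ (Ω : Sph n → ℝ) (f : E n → ℝ) (g : E n → E n),
      AEStronglyMeasurable Ω (surf n) → IsWeakGradient f g → ∀ x : E n, ∃ c : ℤ → ℝ,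
        ∫⁻ y, ‖roughKernel Ω y * (f (x - y) - c (dyadicIndex ‖y‖))‖ₑ ≤
          C * (∫⁻ θ, ‖Ω θ‖ₑ ^ ρ ∂surf n) ^ (1 / ρ) * (morreyNorm α (α * n / β) g ^ (α / β) *
            maximal (fun y => ‖g y‖ₑ ^ α) x ^ (1 / α - 1 / β)) := by
  have hα0 : 0 < α := by linarith
  have hβ0 : 0 < β := by linarith
  obtain ⟨C, hC⟩ := exists_setLIntegral_shell_le hn hρ hs hρs hsα
  -- The means decay like `r^(-β)`, so their `1/α` powers decay like `2^(-θk)`; `α < β` makes this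
  -- beat the factor `2^k`.
  set θ := β / α with hθdef
  have hθ : 1 < θ := (one_lt_div hα0).2 hαβ
  set D : ℝ≥0∞ := C * (ENNReal.ofReal (2 ^ (θ - 1) * twoSidedSum (θ - 1)) *
    (morreyConst n β ^ (1 / α)) ^ (1 / θ)) with hD
  have hDt : D ≠ ⊤ := by
    refine ENNReal.mul_ne_top ENNReal.coe_ne_top (ENNReal.mul_ne_top ENNReal.ofReal_ne_top ?_)
    refine ENNReal.rpow_ne_top_of_nonneg (by positivity) ?_
    exact ENNReal.rpow_ne_top_of_nonneg (by positivity) (morreyConst_ne_top n β)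
  refine ⟨D.toNNReal, fun Ω f g hΩ h x => ?_⟩
  rw [ENNReal.coe_toNNReal hDt]
  obtain ⟨c, hc⟩ := hC Ω f g hΩ h x
  refine ⟨c, ?_⟩
  set N' := (∫⁻ θ, ‖Ω θ‖ₑ ^ ρ ∂surf n) ^ (1 / ρ)
  set M := morreyNorm α (α * n / β) g
  set m := maximal (fun y => ‖g y‖ₑ ^ α) x
  have hshell : ∀ k : ℤ, ∫⁻ y in shell n k,
      ‖roughKernel Ω y * (f (x - y) - c (dyadicIndex ‖y‖))‖ₑ ≤ C * N' *
        (ENNReal.ofReal (2 ^ k) * ballMean (fun y => ‖g y‖ₑ ^ α) x (6 * 2 ^ k) ^ (1 / α)) := by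
    intro k
    refine le_trans (le_of_eq ?_) (hc k)
    refine setLIntegral_congr_fun (measurableSet_shell n k) fun y hy => ?_
    have hy0 : 0 < ‖y‖ := lt_of_lt_of_le (by positivity) hy.1
    simp only [(dyadicIndex_eq_iff hy0 k).2 hy, enorm_mul]
  have hed := tsum_hedberg_le hθ (fun k : ℤ => ballMean (fun y => ‖g y‖ₑ ^ α) x
    (6 * 2 ^ k) ^ (1 / α)) (m ^ (1 / α)) (morreyConst n β ^ (1 / α) * M)
    (fun k => by
      gcongr
      exact ballMean_le_maximal _ _ (by positivity))
    (fun k => by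
      refine (ENNReal.rpow_le_rpow (ballMean_le_morreyNorm hn hα0 β g x
        (show (0 : ℝ) < 6 * 2 ^ k by positivity)) (by positivity)).trans ?_
      rw [ENNReal.mul_rpow_of_nonneg _ _ (by positivity),
        ENNReal.mul_rpow_of_nonneg _ _ (by positivity), ← ENNReal.rpow_mul M,
        mul_one_div_cancel hα0.ne', ENNReal.rpow_one,
        ENNReal.ofReal_rpow_of_nonneg (by positivity) (by positivity)]
      refine mul_le_mul' le_rfl (ENNReal.ofReal_le_ofReal ?_)
      rw [← Real.rpow_mul (by positivity), ← Real.rpow_intCast 2 k,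
        Real.mul_rpow (by norm_num) (by positivity), ← Real.rpow_mul (by norm_num)]
      have e : (k : ℝ) * (-β * (1 / α)) = -θ * k := by rw [hθdef]; ring
      rw [e]
      refine mul_le_of_le_one_left (by positivity) ?_
      refine Real.rpow_le_one_of_one_le_of_nonpos (by norm_num) ?_
      have : 0 < β * (1 / α) := by positivity
      linarith)
  have e1 : 1 / θ = α / β := by rw [hθdef, one_div_div]
  have e2 : 1 / α * (1 - 1 / θ) = 1 / α - 1 / β := by
    rw [e1]; field_simp
  have hθ1 : 0 ≤ 1 / θ := by positivity
  calc _ ≤ ∑' k : ℤ, ∫⁻ y in shell n k,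
        ‖roughKernel Ω y * (f (x - y) - c (dyadicIndex ‖y‖))‖ₑ := lintegral_le_tsum_shell hn _
    _ ≤ ∑' k : ℤ, C * N' * (ENNReal.ofReal (2 ^ k) *
          ballMean (fun y => ‖g y‖ₑ ^ α) x (6 * 2 ^ k) ^ (1 / α)) := ENNReal.tsum_le_tsum hshell
    _ = C * N' * ∑' k : ℤ, ENNReal.ofReal (2 ^ k) *
          ballMean (fun y => ‖g y‖ₑ ^ α) x (6 * 2 ^ k) ^ (1 / α) := ENNReal.tsum_mul_left
    _ ≤ C * N' * (ENNReal.ofReal (2 ^ (θ - 1) * twoSidedSum (θ - 1)) *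
          ((morreyConst n β ^ (1 / α) * M) ^ (1 / θ) * (m ^ (1 / α)) ^ (1 - 1 / θ))) := by
        gcongr
    _ = _ := by
        rw [ENNReal.mul_rpow_of_nonneg _ _ hθ1, ← ENNReal.rpow_mul m, e2, hD, e1]
        ring

/-! ### Existence, size and measurability of the principal value. -/

/-- An annulus away from the origin meets finitely many shells, so the subtracted step function is
bounded there. -/
lemma integrableOn_annulus_roughKernel_mul {n : ℕ} (hn : n ≠ 0) {Ω : Sph n → ℝ}
    (hΩ : Integrable Ω (surf n)) (c : ℤ → ℝ) {ε : ℝ} (hε : 0 < ε) (R : ℝ) :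
    IntegrableOn (fun y => roughKernel Ω y * c (dyadicIndex ‖y‖)) (annulus n ε R) := by
  rcases le_or_gt R 0 with hR | hR
  · have : annulus n ε R = ∅ := by
      ext y
      simp only [annulus, Set.mem_ofPred_eq, Set.mem_empty_iff_false, iff_false, not_and, not_lt]
      exact fun h => hR.trans (norm_nonneg y)
    simp [this]
  have hcm : Measurable fun y : E n => c (dyadicIndex ‖y‖) :=
    (measurable_from_top.comp measurable_dyadicIndex).comp measurable_norm
  set S := Finset.Icc (dyadicIndex ε) (dyadicIndex R)
  set B := ∑ k ∈ S, |c k|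
  have hB : ∀ y ∈ annulus n ε R, |c (dyadicIndex ‖y‖)| ≤ B := by
    intro y hy
    refine Finset.single_le_sum (f := fun k => |c k|) (fun k _ => abs_nonneg _)
      (Finset.mem_Icc.2 ⟨?_, ?_⟩)
    · exact Int.floor_le_floor (Real.logb_le_logb_of_le one_lt_two hε hy.1.le)
    · exact Int.floor_le_floor (Real.logb_le_logb_of_le one_lt_two (hε.trans hy.1) hy.2.le)
  have hsub : annulus n ε R ⊆ Metric.ball 0 R := fun y hy => mem_ball_zero_iff.2 hy.2
  have hdom : IntegrableOn (fun y => angular Ω y * (B / ε ^ n)) (annulus n ε R) :=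
    ((integrableOn_angular hn hΩ hR).mono_set hsub).mul_const _
  refine Integrable.mono hdom ((aestronglyMeasurable_roughKernel hn hΩ.1).mul
    hcm.aestronglyMeasurable).restrict ?_
  filter_upwards [ae_restrict_mem (measurableSet_annulus n ε R)] with y hy
  have hy0 : 0 < ‖y‖ := hε.trans hy.1
  have hB0 : 0 ≤ B := Finset.sum_nonneg fun k _ => abs_nonneg _
  rw [roughKernel_eq, norm_mul, norm_div, norm_mul, norm_pow, norm_norm,
    Real.norm_of_nonneg (by positivity : 0 ≤ B / ε ^ n), Real.norm_eq_abs (c _), div_mul_eq_mul_div,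
    mul_div_assoc]
  gcongr
  · exact hB y hy
  · exact hy.1.le

lemma truncatedIntegral_eq {n : ℕ} (hn : n ≠ 0) {Ω : Sph n → ℝ} (hΩ : Integrable Ω (surf n))
    (h0 : ∫ θ, Ω θ ∂surf n = 0) {f : E n → ℝ} {x : E n} {c : ℤ → ℝ}
    (hi : Integrable fun y => roughKernel Ω y * (f (x - y) - c (dyadicIndex ‖y‖)))
    {ε : ℝ} (hε : 0 < ε) (R : ℝ) :
    IntegrableOn (fun y => roughKernel Ω y * f (x - y)) (annulus n ε R) ∧
      truncatedIntegral Ω f x ε R =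
        ∫ y in annulus n ε R, roughKernel Ω y * (f (x - y) - c (dyadicIndex ‖y‖)) := by
  have h1 := integrableOn_annulus_roughKernel_mul hn hΩ c hε R
  have e : (fun y => roughKernel Ω y * f (x - y)) = fun y =>
      roughKernel Ω y * (f (x - y) - c (dyadicIndex ‖y‖)) +
        roughKernel Ω y * c (dyadicIndex ‖y‖) := by
    ext y; ring
  refine ⟨?_, ?_⟩
  · rw [e]
    exact hi.integrableOn.add h1
  · rw [truncatedIntegral, e, integral_add hi.integrableOn h1,
      setIntegral_roughKernel_mul_radial hn h0 (fun r => c (dyadicIndex r)) ε R, add_zero]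

lemma tendsto_setIntegral_annulus {n : ℕ} (hn : n ≠ 0) {F : E n → ℝ} (hF : Integrable F) :
    Tendsto (fun p : ℝ × ℝ => ∫ y in annulus n p.1 p.2, F y) (𝓝[>] (0 : ℝ) ×ˢ atTop)
      (𝓝 (∫ y, F y)) := by
  have := nontrivial_euclidean hn
  simp_rw [← integral_indicator (measurableSet_annulus n _ _)]
  refine tendsto_integral_filter_of_dominated_convergence (fun y => ‖F y‖)
    (Eventually.of_forall fun p => hF.1.indicator (measurableSet_annulus n _ _))
    (Eventually.of_forall fun p => ae_of_all _ fun y => norm_indicator_le_norm_self _ _)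
    hF.norm ?_
  have hne : ∀ᵐ y : E n, y ≠ 0 := by
    rw [ae_iff]; simp
  filter_upwards [hne] with y hy
  refine tendsto_const_nhds.congr' ?_
  have h1 : ∀ᶠ ε in 𝓝[>] (0 : ℝ), ε < ‖y‖ :=
    (eventually_lt_nhds (norm_pos_iff.2 hy)).filter_mono nhdsWithin_le_nhds
  filter_upwards [h1.prod_mk (eventually_gt_atTop ‖y‖)] with p hp
  exact (Set.indicator_of_mem (show y ∈ annulus n p.1 p.2 from hp) F).symm

/-- Existence and size of the principal value. -/
theorem hasPrincipalValue_of_lintegral_lt_top {n : ℕ} (hn : n ≠ 0) {Ω : Sph n → ℝ}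
    (hΩ : Integrable Ω (surf n)) (h0 : ∫ θ, Ω θ ∂surf n = 0) {f : E n → ℝ}
    (hf : AEStronglyMeasurable f) {x : E n} {c : ℤ → ℝ}
    (hfin : ∫⁻ y, ‖roughKernel Ω y * (f (x - y) - c (dyadicIndex ‖y‖))‖ₑ < ⊤) :
    HasPrincipalValue Ω f x (roughOperator Ω f x) ∧ ‖roughOperator Ω f x‖ₑ ≤
      ∫⁻ y, ‖roughKernel Ω y * (f (x - y) - c (dyadicIndex ‖y‖))‖ₑ := by
  have hcm : Measurable fun y : E n => c (dyadicIndex ‖y‖) :=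
    (measurable_from_top.comp measurable_dyadicIndex).comp measurable_norm
  have hi : Integrable fun y => roughKernel Ω y * (f (x - y) - c (dyadicIndex ‖y‖)) :=
    ⟨(aestronglyMeasurable_roughKernel hn hΩ.1).mul
      ((hf.comp_quasiMeasurePreserving (quasiMeasurePreserving_sub_left volume x)).sub
        hcm.aestronglyMeasurable), hfin⟩
  have ht := tendsto_setIntegral_annulus hn hi
  have ht' : Tendsto (fun p : ℝ × ℝ => truncatedIntegral Ω f x p.1 p.2) (𝓝[>] (0 : ℝ) ×ˢ atTop)
      (𝓝 (∫ y, roughKernel Ω y * (f (x - y) - c (dyadicIndex ‖y‖)))) := by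
    refine ht.congr' ?_
    have h1 : ∀ᶠ ε in 𝓝[>] (0 : ℝ), 0 < ε := eventually_mem_nhdsWithin
    filter_upwards [h1.prod_inl (atTop : Filter ℝ)] with p hp
    exact (truncatedIntegral_eq hn hΩ h0 hi hp p.2).2.symm
  have hL : roughOperator Ω f x =
      ∫ y, roughKernel Ω y * (f (x - y) - c (dyadicIndex ‖y‖)) := ht'.limUnder_eq
  refine ⟨⟨fun ε R hε => (truncatedIntegral_eq hn hΩ h0 hi hε R).1, hL ▸ ht'⟩, ?_⟩
  rw [hL]
  exact enorm_integral_le_lintegral_enorm _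

/-- Almost everywhere the operator is the limit along the single sequence `ε = 1/(m+1)`, `R = m` of
truncations, which are measurable as parametric integrals. -/
lemma aestronglyMeasurable_roughOperator {n : ℕ} (hn : n ≠ 0) {Ω : Sph n → ℝ}
    (hΩ : AEStronglyMeasurable Ω (surf n)) {f : E n → ℝ} (hf : AEStronglyMeasurable f)
    (h : ∀ᵐ x, HasPrincipalValue Ω f x (roughOperator Ω f x)) :
    AEStronglyMeasurable (roughOperator Ω f) volume := by
  have hseq : Tendsto (fun m : ℕ => ((1 / ((m : ℝ) + 1), (m : ℝ)) : ℝ × ℝ)) atTop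
      (𝓝[>] (0 : ℝ) ×ˢ atTop) := by
    refine Tendsto.prodMk ?_ tendsto_natCast_atTop_atTop
    refine tendsto_nhdsWithin_iff.2 ⟨tendsto_one_div_add_atTop_nhds_zero_nat, ?_⟩
    exact Eventually.of_forall fun m => by simp only [Set.mem_Ioi]; positivity
  refine aestronglyMeasurable_of_tendsto_ae atTop
    (f := fun (m : ℕ) x => truncatedIntegral Ω f x (1 / ((m : ℝ) + 1)) m) (fun m => ?_)
    (h.mono fun x hx => hx.2.comp hseq)
  have h1 : AEStronglyMeasurable (fun q : E n × E n => roughKernel Ω q.2 * f (q.1 - q.2))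
      ((volume : Measure (E n)).prod volume) := by
    refine ((aestronglyMeasurable_roughKernel hn hΩ).comp_snd).mul ?_
    exact hf.comp_quasiMeasurePreserving (quasiMeasurePreserving_sub volume volume)
  have h2 := (h1.indicator (s := Prod.snd ⁻¹' annulus n (1 / ((m : ℝ) + 1)) m)
    (measurable_snd (measurableSet_annulus n _ _))).integral_prod_right'
  refine h2.congr (ae_of_all _ fun x => ?_)
  simp only
  rw [truncatedIntegral, ← integral_indicator (measurableSet_annulus n _ _)]
  rfl

/-! ### Luxemburg norms and the passage from the pointwise to the Orlicz bound. -/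

lemma IsYoung.map_zero {A : ℝ → ℝ} (hA : IsYoung A) : A 0 = 0 := by
  obtain ⟨a, -, -, -, h⟩ := hA
  simpa using h 0 le_rfl

lemma IsYoung.monotoneOn {A : ℝ → ℝ} (hA : IsYoung A) : MonotoneOn A (Set.Ici 0) := by
  obtain ⟨a, ha0, ha, -, h⟩ := hA
  intro s hs t ht hst
  have hs' : (0 : ℝ) ≤ s := hs
  have ht' : (0 : ℝ) ≤ t := ht
  rw [h s hs, h t ht]
  refine intervalIntegral.integral_mono_interval le_rfl hs' hst ?_ ?_
  · filter_upwards [ae_restrict_mem measurableSet_Ioc] with r hr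
    have := ha (by simp : (0 : ℝ) ∈ Set.Ici 0) (show r ∈ Set.Ici 0 from hr.1.le) hr.1.le
    simpa [ha0] using this
  · refine MonotoneOn.intervalIntegrable (ha.mono ?_)
    rw [Set.uIcc_of_le ht']
    exact fun r hr => hr.1

lemma IsYoung.rescale_monotoneOn {A : ℝ → ℝ} (hA : IsYoung A) {σ : ℝ} (hσ : 0 ≤ σ) :
    MonotoneOn (rescale A σ) (Set.Ici 0) := fun _ hs _ ht hst =>
  hA.monotoneOn (Real.rpow_nonneg hs σ) (Real.rpow_nonneg ht σ)
    (Real.rpow_le_rpow hs hst hσ)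

lemma maximal_const_mul {n : ℕ} {c : ℝ≥0∞} (hc : c ≠ ⊤) (h : E n → ℝ≥0∞) (x : E n) :
    maximal (fun y => c * h y) x = c * maximal h x := by
  simp only [maximal, ENNReal.mul_iSup, lintegral_const_mul' _ _ hc, mul_div_assoc]

lemma luxemburgNorm_le {n : ℕ} {F : Type*} [NormedAddCommGroup F] {A : ℝ → ℝ} {f : E n → F}
    {l : ℝ} (hl : 0 < l) (h : ∫⁻ x, ENNReal.ofReal (A (‖f x‖ / l)) ≤ 1) :
    luxemburgNorm A f ≤ ENNReal.ofReal l :=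
  iInf₂_le_of_le l hl (iInf_le _ h)

lemma luxemburgNorm_eq_zero_of_ae {n : ℕ} {A : ℝ → ℝ} (hA : A 0 = 0) {f : E n → ℝ}
    (hf : ∀ᵐ x, f x = 0) : luxemburgNorm A f = 0 := by
  have key : ∀ l : ℝ≥0, 0 < l → luxemburgNorm A f ≤ l := by
    intro l hl
    rw [← ENNReal.ofReal_coe_nnreal]
    refine luxemburgNorm_le (by exact_mod_cast hl) ?_
    have : (fun x => ENNReal.ofReal (A (‖f x‖ / l))) =ᵐ[volume] 0 :=
      hf.mono fun x hx => by simp [hx, hA]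
    rw [lintegral_congr_ae this]
    simp
  refine le_antisymm (ENNReal.le_of_forall_pos_le_add fun l hl _ => ?_) zero_le
  rw [zero_add]
  exact key l hl

/-- Solving for the norm, `(X / Q)^(1/κ) ≤ μ` for every admissible `μ`, lets the infimum be taken,
including when no `μ` is admissible. -/
lemma le_mul_luxemburgNorm_rpow {n : ℕ} {F : Type*} [NormedAddCommGroup F] {A : ℝ → ℝ}
    {g : E n → F} {X Q : ℝ≥0∞} (hQ0 : Q ≠ 0) (hQt : Q ≠ ⊤) {κ : ℝ} (hκ : 0 < κ)
    (h : ∀ μ : ℝ, 0 < μ → ∫⁻ x, ENNReal.ofReal (A (‖g x‖ / μ)) ≤ 1 →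
      X ≤ Q * ENNReal.ofReal μ ^ κ) : X ≤ Q * luxemburgNorm A g ^ κ := by
  have h1 : (X / Q) ^ κ⁻¹ ≤ luxemburgNorm A g := by
    refine le_iInf fun μ => le_iInf fun hμ => le_iInf fun hi => ?_
    rw [ENNReal.rpow_inv_le_iff hκ]
    exact ENNReal.div_le_of_le_mul' (h μ hμ hi)
  rw [ENNReal.rpow_inv_le_iff hκ, ENNReal.div_le_iff hQ0 hQt] at h1
  rwa [mul_comm]

/-- A pointwise bound by a power of the maximal function gives an Orlicz bound. -/
theorem exists_luxemburgNorm_le {n : ℕ} (hn : n ≠ 0) {α β : ℝ} (hα : 0 < α) (hαβ : α < β)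
    {A : ℝ → ℝ} (hA : IsYoung A) (hA2 : Nabla2 (rescale A (1 / α - 1 / β))) :
    ∃ c : ℝ≥0, ∀ (T : E n → ℝ) (g : E n → E n) (P : ℝ≥0∞), P ≠ ⊤ →
      AEStronglyMeasurable g → (∀ᵐ x, maximal (fun y => ‖g y‖ₑ ^ α) x < ⊤) →
      (∀ᵐ x, ‖T x‖ₑ ≤ P * maximal (fun y => ‖g y‖ₑ ^ α) x ^ (1 / α - 1 / β)) →
      luxemburgNorm A T ≤
        c * P * luxemburgNorm (rescale A (1 - α / β)) g ^ (1 - α / β) := by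
  have hβ : 0 < β := hα.trans hαβ
  set σ := 1 / α - 1 / β with hσdef
  set κ := 1 - α / β with hκdef
  have hσ : 0 < σ := sub_pos.2 (one_div_lt_one_div_of_lt hα hαβ)
  have hκ : 0 < κ := by rw [hκdef, sub_pos, div_lt_one hβ]; exact hαβ
  have hασ : α * σ = κ := by rw [hσdef, hκdef]; field_simp
  have hmono := hA.rescale_monotoneOn hσ.le
  have hB0 : rescale A σ 0 = 0 := by
    rw [rescale, Real.zero_rpow hσ.ne', hA.map_zero]
  obtain ⟨c, hc, hmod⟩ := exists_lintegral_comp_maximal_le hn hmono hB0 hA2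
  refine ⟨Real.toNNReal (c ^ σ), fun T g P hPt hg hfin hT => ?_⟩
  -- This is where the convention `0 * ∞ = 0` matters: for `P = 0` the function vanishes almost
  -- everywhere.
  rcases eq_or_ne P 0 with rfl | hP0
  · rw [luxemburgNorm_eq_zero_of_ae hA.map_zero (hT.mono fun x hx => by simpa using hx)]
    exact zero_le
  have hcσ : 0 < c ^ σ := Real.rpow_pos_of_pos hc σ
  have hP : 0 < P.toReal := ENNReal.toReal_pos hP0 hPt
  refine le_mul_luxemburgNorm_rpow (mul_ne_zero (by simpa using hcσ) hP0)
    (ENNReal.mul_ne_top ENNReal.coe_ne_top hPt) hκ fun μ hμ hi => ?_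
  -- Chosen so that `c * h = (‖g‖ / μ)^α`; applying `A_σ` to it yields `A_κ (‖g‖ / μ)`, whose
  -- integral is at most one.
  set k : ℝ := 1 / (c * μ ^ α) with hk
  have hk0 : 0 < k := by positivity
  set h : E n → ℝ := fun y => k * ‖g y‖ ^ α with hh
  have hhn : ∀ y, 0 ≤ h y := fun y => by positivity
  have hmax : ∀ x, maximal (fun y => ENNReal.ofReal (h y)) x =
      ENNReal.ofReal k * maximal (fun y => ‖g y‖ₑ ^ α) x := by
    intro x
    rw [← maximal_const_mul ENNReal.ofReal_ne_top]
    congr 1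
    ext y
    rw [hh, ENNReal.ofReal_mul hk0.le, ← ENNReal.ofReal_rpow_of_nonneg (norm_nonneg _) hα.le,
      ofReal_norm]
  have hmodh := hmod h ((hg.norm.aemeasurable.pow_const α).const_mul k) hhn
    (hfin.mono fun x hx => by
      rw [hmax]; exact ENNReal.mul_lt_top ENNReal.ofReal_lt_top hx)
  set l := c ^ σ * P.toReal * μ ^ κ with hl
  have hl0 : 0 < l := by positivity
  have hle : ∫⁻ x, ENNReal.ofReal (A (‖T x‖ / l)) ≤ 1 := by
    calc ∫⁻ x, ENNReal.ofReal (A (‖T x‖ / l))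
        ≤ ∫⁻ x, ENNReal.ofReal
            (rescale A σ (maximal (fun y => ENNReal.ofReal (h y)) x).toReal) := by
          refine lintegral_mono_ae ?_
          filter_upwards [hfin, hT] with x hx hTx
          refine ENNReal.ofReal_le_ofReal (hA.monotoneOn (Set.mem_Ici.2 (by positivity))
            (Set.mem_Ici.2 (by positivity)) ?_)
          have hne : maximal (fun y => ‖g y‖ₑ ^ α) x ^ σ ≠ ⊤ :=
            ENNReal.rpow_ne_top_of_nonneg hσ.le hx.ne
          have h1 := ENNReal.toReal_mono (ENNReal.mul_ne_top hPt hne) hTx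
          rw [toReal_enorm, ENNReal.toReal_mul, ← ENNReal.toReal_rpow] at h1
          rw [hmax, ENNReal.toReal_mul, ENNReal.toReal_ofReal hk0.le,
            Real.mul_rpow hk0.le ENNReal.toReal_nonneg, div_le_iff₀ hl0]
          refine h1.trans (le_of_eq ?_)
          have e : k ^ σ * (c ^ σ * μ ^ κ) = 1 := by
            rw [hk, Real.div_rpow zero_le_one (by positivity), Real.one_rpow,
              Real.mul_rpow hc.le (by positivity), ← Real.rpow_mul hμ.le, hασ]
            field_simp
          rw [hl]
          linear_combination (-(P.toReal *
            (maximal (fun y => ‖g y‖ₑ ^ α) x).toReal ^ σ)) * e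
      _ ≤ ∫⁻ x, ENNReal.ofReal (rescale A σ (c * h x)) := hmodh
      _ = ∫⁻ x, ENNReal.ofReal (rescale A κ (‖g x‖ / μ)) := by
          refine lintegral_congr fun x => ?_
          have e : c * h x = (‖g x‖ / μ) ^ α := by
            rw [hh, hk, Real.div_rpow (norm_nonneg _) hμ.le]
            field_simp
          rw [e, rescale, rescale, ← Real.rpow_mul (by positivity), hασ]
      _ ≤ 1 := hi
  refine (luxemburgNorm_le hl0 hle).trans (le_of_eq ?_)
  rw [hl, ENNReal.ofReal_mul (by positivity), ENNReal.ofReal_mul hcσ.le, ENNReal.ofReal_toReal hPt,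
    ENNReal.ofReal_rpow_of_pos hμ]
  rfl

end RoughOrlicz

end

/-! ### The main theorem. -/

theorem mainTheorem4 (n : ℕ) (hn : 2 ≤ n) (ρ α β : ℝ) (hρ : 1 < ρ) (hρn : ρ < n)
    (hα : ρ * n / (ρ * n + ρ - n) ≤ α) (hα1 : 1 < α) (hαβ : α < β) (hβ : β < n)
    (A : ℝ → ℝ) (hA : RoughOrlicz.IsYoung A)
    (hA2 : RoughOrlicz.Nabla2 (RoughOrlicz.rescale A (1 / α - 1 / β))) :
    ∃ C : ℝ≥0, ∀ (Ω : RoughOrlicz.Sph n → ℝ),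
      Integrable Ω (RoughOrlicz.surf n) → ∫ θ, Ω θ ∂(RoughOrlicz.surf n) = 0 →
      MemLp Ω (ENNReal.ofReal ρ) (RoughOrlicz.surf n) →
      ∀ (f : RoughOrlicz.E n → ℝ) (gradf : RoughOrlicz.E n → RoughOrlicz.E n),
        RoughOrlicz.IsWeakGradient f gradf →
        RoughOrlicz.MemMorrey α (α * n / β) gradf →
        (∀ᵐ x, RoughOrlicz.HasPrincipalValue Ω f x (RoughOrlicz.roughOperator Ω f x)) ∧
        AEStronglyMeasurable (RoughOrlicz.roughOperator Ω f) volume ∧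
        RoughOrlicz.luxemburgNorm A (RoughOrlicz.roughOperator Ω f) ≤
          C * eLpNorm Ω (ENNReal.ofReal ρ) (RoughOrlicz.surf n) *
            RoughOrlicz.morreyNorm α (α * n / β) gradf ^ (α / β) *
            RoughOrlicz.luxemburgNorm (RoughOrlicz.rescale A (1 - α / β)) gradf ^ (1 - α / β) := by
  have hn0 : n ≠ 0 := by omega
  have hnr : (0 : ℝ) < n := by exact_mod_cast Nat.pos_of_ne_zero hn0
  have hα0 : 0 < α := by linarith
  have hβ0 : 0 < β := by linarith
  have hρ0 : 0 < ρ := by linarith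
  have hden : 0 < ρ * n + ρ - n := by nlinarith
  -- `s` is the exponent whose Sobolev conjugate is the Hölder conjugate of `ρ`. The condition `s >
  -- 1` amounts to `ρ < n`, and `hα` now reads `s ≤ α`.
  set s := ρ * n / (ρ * n + ρ - n) with hs
  have hs1 : 1 < s := by rw [hs, one_lt_div hden]; linarith
  have hρs : 1 / ρ + 1 / s = 1 + 1 / n := by
    rw [hs, one_div_div]
    field_simp
    ring
  have hσ : 0 ≤ 1 / α - 1 / β := sub_nonneg.2 (one_div_le_one_div_of_le hα0 hαβ.le)
  obtain ⟨C₁, hC₁⟩ := RoughOrlicz.exists_lintegral_roughKernel_mul_le hn0 hρ hs1 hρs hα hαβ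
  obtain ⟨c, hc⟩ := RoughOrlicz.exists_luxemburgNorm_le hn0 hα0 hαβ hA hA2
  refine ⟨c * C₁, fun Ω hΩ hΩ0 hΩρ f g h hM => ?_⟩
  have hnorm : eLpNorm Ω (ENNReal.ofReal ρ) (RoughOrlicz.surf n) =
      (∫⁻ θ, ‖Ω θ‖ₑ ^ ρ ∂(RoughOrlicz.surf n)) ^ (1 / ρ) := by
    rw [eLpNorm_eq_lintegral_rpow_enorm_toReal (by simpa using hρ0) ENNReal.ofReal_ne_top,
      ENNReal.toReal_ofReal hρ0.le]
  have hfin := RoughOrlicz.ae_maximal_lt_top hn0 hα0 hβ0 hM.2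
  set N := eLpNorm Ω (ENNReal.ofReal ρ) (RoughOrlicz.surf n)
  set M := RoughOrlicz.morreyNorm α (α * n / β) g
  have hP : C₁ * N * M ^ (α / β) ≠ ⊤ :=
    ENNReal.mul_ne_top (ENNReal.mul_ne_top ENNReal.coe_ne_top hΩρ.2.ne)
      (ENNReal.rpow_ne_top_of_nonneg (by positivity) hM.2.ne)
  have hpt : ∀ᵐ x, RoughOrlicz.HasPrincipalValue Ω f x (RoughOrlicz.roughOperator Ω f x) ∧
      ‖RoughOrlicz.roughOperator Ω f x‖ₑ ≤ C₁ * N * M ^ (α / β) *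
        RoughOrlicz.maximal (fun y => ‖g y‖ₑ ^ α) x ^ (1 / α - 1 / β) := by
    filter_upwards [hfin] with x hx
    obtain ⟨k, hk⟩ := hC₁ Ω f g hΩ.1 h x
    rw [← hnorm, ← mul_assoc] at hk
    obtain ⟨h1, h2⟩ := RoughOrlicz.hasPrincipalValue_of_lintegral_lt_top hn0 hΩ hΩ0
      h.locallyIntegrable.aestronglyMeasurable (hk.trans_lt
        (ENNReal.mul_lt_top hP.lt_top (ENNReal.rpow_lt_top_of_nonneg hσ hx.ne)))
    exact ⟨h1, h2.trans hk⟩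
  have hpv := hpt.mono fun x hx => hx.1
  refine ⟨hpv, RoughOrlicz.aestronglyMeasurable_roughOperator hn0 hΩ.1
    h.locallyIntegrable.aestronglyMeasurable hpv, ?_⟩
  refine (hc _ g _ hP hM.1 hfin (hpt.mono fun x hx => hx.2)).trans (le_of_eq ?_)
  push_cast
  ring
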